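/- \textbf{Setting.} Fix $P,\sigma^2,\sigma_w^2>0$. There are $\ell$ users, of which $k=k(\ell)$ are active; the active set $\mathcal A$ is uniform among the $k$-subsets of $\{1,\dots,\ell\}$. User $i$ has a binary preamble $(X^i_1,\dots,X^i_n)\in\{0,\sqrt P\}^n$. In channel use $t=1,\dots,n$ the received symbol is $S_t=\sum_{i\in\mathcal A}h^i_tX^i_t+W_t$, where all $h^i_t\sim\mathcal{CN}(0,\sigma^2)$ and $W_t\sim\mathcal{CN}(0,\sigma_w^2)$ are independent, and the receiver observes only $Z_t=1$ if $|S_t|^2>\gamma$ and $Z_t=0$ otherwise, for a threshold $\gamma>0$. A detection function maps $(Z_1,\dots,Z_n)$ to a $k$-subset of the users; the receiver knows the preambles. The error probability $\mathbb P_e^{(\ell)}$ is the probability that the estimated set differs from $\mathcal A$. In the \emph{Bernoulli} version the preamble symbols are independent, those of user $i$ being equal to $\sqrt P$ with probability $q_i$, the detection function may depend on the realized preambles, $\mathbb P_e^{(\ell)}$ is averaged over the preambles, and the free choices are $\gamma>0$, $(q_i)\in[0,1]^\ell$ and the detection functions. In the \emph{fixed-preamble} version the free choices are $\gamma>0$,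 the (deterministic) preambles and the detection function. A function $n(\ell)$ is the \emph{minimum user identification cost} if for every $0<\varepsilon<1$: with $\lceil(1+\varepsilon)n(\ell)\rceil$ channel uses there are choices for which $\mathbb P_e^{(\ell)}\to0$ as $\ell\to\infty$, and with $\lfloor(1-\varepsilon)n(\ell)\rfloor$ channel uses there is $\delta>0$ such that, for all sufficiently large $\ell$, $\mathbb P_e^{(\ell)}\ge\delta$ for all choices. \textbf{Theorem.} For $\kappa\ge1$ let $$C_\kappa=\max_{\gamma>0,\;q_{sp}\in[0,1]}\; h\Big(E\Big[e^{-\frac{\gamma}{V\sigma^2P+\sigma_w^2}}\Big]\Big)-E\Big[h\Big(e^{-\frac{\gamma}{V\sigma^2P+\sigma_w^2}}\Big)\Big],\qquad V\sim\mathrm{Bin}(\kappa,q_{sp}),$$ where $h(x)=-x\log_2x-(1-x)\log_2(1-x)$. This maximum is attained and positive. If $k=k(\ell)=\Theta(1)$, then the minimum user identification cost is $$n(\ell)=\frac{k\log_2\ell}{C_k},$$ both in the Bernoulli version and in the fixed-preamble version. Moreover, if $(\gamma_\kappa,q_\kappa)$ attains the maximum $C_\kappa$ for each $\kappa\ge1$,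 then for every $0<\varepsilon<1$ the threshold $\gamma_k$ and i.i.d. preambles with common sampling probability $q_k$ achieve $\mathbb P_e^{(\ell)}\to0$ (averaged over the preambles, with suitable detection functions) with $\lceil(1+\varepsilon)n(\ell)\rceil$ channel uses. -/

import Mathlib

open MeasureTheory ProbabilityTheory Filter Topology Asymptotics

noncomputable section

namespace MnAC

/-- The circularly symmetric complex Gaussian law `CN(0, v)`: the real and the imaginary part are
independent `N(0, v / 2)`. -/
def complexGaussian (v : ℝ) : Measure ℂ :=
  ((gaussianReal 0 (Real.toNNReal (v / 2))).prod (gaussianReal 0 (Real.toNNReal (v / 2)))).map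
    (fun p : ℝ × ℝ => (⟨p.1, p.2⟩ : ℂ))

/-- Joint law of the fading coefficients `h_t^i ∼ CN(0, σ²)` and of the noise `W_t ∼ CN(0, σw²)`
over `n` channel uses and `ℓ` users, all independent (fast fading). For an outcome `ω`,
`(ω t).1 i` is `h_t^i` and `(ω t).2` is `W_t`. -/
def channelLaw (σ σw : ℝ) (ℓ n : ℕ) : Measure (Fin n → (Fin ℓ → ℂ) × ℂ) :=
  Measure.pi fun _ : Fin n =>
    (Measure.pi fun _ : Fin ℓ => complexGaussian (σ ^ 2)).prod (complexGaussian (σw ^ 2))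

/-- A set of binary preambles of length `n`, one for each of the `ℓ` users: `x i t = true` means
that user `i` has an `On` symbol in channel use `t`. -/
abbrev Preambles (ℓ n : ℕ) : Type := Fin ℓ → Fin n → Bool

/-- OOK modulation: the `On` symbol is `√P`, the `Off` symbol is `0`. -/
def ook (P : ℝ) (b : Bool) : ℝ := if b then Real.sqrt P else 0

/-- The received symbol `S_t`, the superposition of the faded OOK symbols of the active users `A`,
plus noise. -/
def received (P : ℝ) {ℓ n : ℕ} (x : Preambles ℓ n) (A : Finset (Fin ℓ))
    (ω : Fin n → (Fin ℓ → ℂ) × ℂ) (t : Fin n) : ℂ :=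
  (∑ i ∈ A, (ω t).1 i * (ook P (x i t) : ℂ)) + (ω t).2

open Classical in
/-- The output of the energy detector with threshold `γ`: `Z_t = 1` iff `|S_t|² > γ`. -/
def detectorOutput (P γ : ℝ) {ℓ n : ℕ} (x : Preambles ℓ n) (A : Finset (Fin ℓ))
    (ω : Fin n → (Fin ℓ → ℂ) × ℂ) : Fin n → Bool :=
  fun t => decide (γ < ‖received P x A ω t‖ ^ 2)

/-- An activity detection function: a deterministic rule from the binary outputs to an estimate of
the active set (the support of the activity vector) with exactly `k` elements. -/
structure Detector (ℓ n k : ℕ) where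
  estimate : (Fin n → Bool) → Finset (Fin ℓ)
  card_estimate : ∀ z, (estimate z).card = k

/-- Probability of erroneous identification for the preambles `x`, the threshold `γ` and the
detection function `g`, with the active set uniform among the `k`-subsets of the users. -/
def errorProb (P σ σw γ : ℝ) {ℓ n k : ℕ} (x : Preambles ℓ n) (g : Detector ℓ n k) : ℝ :=
  (1 / (ℓ.choose k : ℝ)) * ∑ A ∈ (Finset.univ : Finset (Fin ℓ)).powersetCard k,
    (channelLaw σ σw ℓ n).real {ω | g.estimate (detectorOutput P γ x A ω) ≠ A}

/-- Probability of the preamble set `x` when all the symbols are independent and those of user `i`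
are `Bern(q i)`. -/
def preambleProb {ℓ n : ℕ} (q : Fin ℓ → ℝ) (x : Preambles ℓ n) : ℝ :=
  ∏ i, ∏ t, if x i t then q i else 1 - q i

/-- Probability of erroneous identification with random Bernoulli preambles that are known to the
receiver: the detection function may depend on the realisation `x` of the preambles. -/
def bernoulliErrorProb (P σ σw γ : ℝ) {ℓ n k : ℕ} (q : Fin ℓ → ℝ)
    (g : Preambles ℓ n → Detector ℓ n k) : ℝ :=
  ∑ x : Preambles ℓ n, preambleProb q x * errorProb P σ σw γ x (g x)

/-- `N ℓ` is the minimum user identification cost with `k ℓ` active users among `ℓ`, when the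
preamble set may be chosen freely: with `(1 + ε) N ℓ` channel uses some preambles, threshold and
detection function make the error probability vanish as `ℓ → ∞`, whereas with `(1 - ε) N ℓ`
channel uses the error probability stays above a positive constant, whatever they are. -/
def IsMinCostFixed (P σ σw : ℝ) (k : ℕ → ℕ) (N : ℕ → ℝ) : Prop :=
  ∀ ε : ℝ, 0 < ε → ε < 1 →
    (∃ e : ℕ → ℝ, Tendsto e atTop (𝓝 0) ∧ ∀ᶠ ℓ in atTop,
      ∃ (γ : ℝ) (x : Preambles ℓ ⌈(1 + ε) * N ℓ⌉₊) (g : Detector ℓ ⌈(1 + ε) * N ℓ⌉₊ (k ℓ)),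
        0 < γ ∧ errorProb P σ σw γ x g = e ℓ) ∧
    (∃ δ : ℝ, 0 < δ ∧ ∀ᶠ ℓ in atTop,
      ∀ (γ : ℝ) (x : Preambles ℓ ⌊(1 - ε) * N ℓ⌋₊) (g : Detector ℓ ⌊(1 - ε) * N ℓ⌋₊ (k ℓ)),
        0 < γ → δ ≤ errorProb P σ σw γ x g)

/-- `N ℓ` is the minimum user identification cost with `k ℓ` active users among `ℓ`, when the
preambles are generated by independent Bernoulli processes, so that only the threshold, the
sampling probabilities `q i` of the users and the detection rule can be chosen. -/
def IsMinCostBernoulli (P σ σw : ℝ) (k : ℕ → ℕ) (N : ℕ → ℝ) : Prop :=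
  ∀ ε : ℝ, 0 < ε → ε < 1 →
    (∃ e : ℕ → ℝ, Tendsto e atTop (𝓝 0) ∧ ∀ᶠ ℓ in atTop,
      ∃ (γ : ℝ) (q : Fin ℓ → ℝ)
        (g : Preambles ℓ ⌈(1 + ε) * N ℓ⌉₊ → Detector ℓ ⌈(1 + ε) * N ℓ⌉₊ (k ℓ)),
        0 < γ ∧ (∀ i, q i ∈ Set.Icc (0 : ℝ) 1) ∧ bernoulliErrorProb P σ σw γ q g = e ℓ) ∧
    (∃ δ : ℝ, 0 < δ ∧ ∀ᶠ ℓ in atTop,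
      ∀ (γ : ℝ) (q : Fin ℓ → ℝ)
        (g : Preambles ℓ ⌊(1 - ε) * N ℓ⌋₊ → Detector ℓ ⌊(1 - ε) * N ℓ⌋₊ (k ℓ)),
        0 < γ → (∀ i, q i ∈ Set.Icc (0 : ℝ) 1) → δ ≤ bernoulliErrorProb P σ σw γ q g)

/-- The binary entropy function, in bits. -/
def h (x : ℝ) : ℝ := -x * Real.logb 2 x - (1 - x) * Real.logb 2 (1 - x)

/-- `E[f(V)]` for `V ∼ Bin(κ, q)`. -/
def binomialExp (κ : ℕ) (q : ℝ) (f : ℕ → ℝ) : ℝ :=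
  ∑ v ∈ Finset.range (κ + 1), (κ.choose v : ℝ) * q ^ v * (1 - q) ^ (κ - v) * f v

/-- `exp(-γ / (v σ² P + σw²))`. -/
def onProb (P σ σw γ : ℝ) (v : ℕ) : ℝ := Real.exp (-(γ / (v * σ ^ 2 * P + σw ^ 2)))

/-- The objective `h(E[exp(-γ/(Vσ²P+σw²))]) - E[h(exp(-γ/(Vσ²P+σw²)))]`, `V ∼ Bin(κ, q)`. -/
def rate (P σ σw : ℝ) (κ : ℕ) (γ q : ℝ) : ℝ :=
  h (binomialExp κ q (onProb P σ σw γ)) - binomialExp κ q (fun v => h (onProb P σ σw γ v))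

/-- The values of the objective over all thresholds and sampling probabilities. -/
def rateSet (P σ σw : ℝ) (κ : ℕ) : Set ℝ :=
  {r | ∃ γ q : ℝ, 0 < γ ∧ q ∈ Set.Icc (0 : ℝ) 1 ∧ r = rate P σ σw κ γ q}

/-- The maximum rate `C` with `κ` active users. -/
def maxRate (P σ σw : ℝ) (κ : ℕ) : ℝ := sSup (rateSet P σ σw κ)

end MnAC

end

noncomputable section

namespace MnAC

/-! Given the preambles, a sum of independent faded symbols plus noise is again circular Gaussian,
so its energy is exponential. The detector output in one slot is therefore Bernoulli, with a
parameter `onProb v` that depends only on the number `v` of active users that are On. Slots are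
independent, so `errorProb_eq` turns the problem into finite sums for a memoryless binary channel
with input `v`.

Converse (`correct_prob_le`): the active set is replaced by a tuple of `κ` users drawn with
replacement. Then `v` is exactly binomial in each slot, with success probability the fraction of On
users, so each slot carries mutual information at most `C_κ`, even for deterministic preambles. The
joint law of tuple and output is compared with the product of its tuple law and the product of its
slotwise output laws. Under the latter a correct estimate has probability `κ! / ℓ ^ κ`, and the data
processing bound `le_relEntropy` forces `n` to be of order at least `κ log₂ ℓ / C_κ` unless errors
persist.

Achievability (`bernoulliErrorProb_thresholdDetector_le`): with i.i.d. columns, a set is accepted if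
every nonempty subset `D` of it passes a likelihood ratio test against `|D|` unknown users. The true
set is rejected with exponentially small probability as long as the thresholds stay below the
information `I_i` that `i` users carry given the other `κ - i`. A wrong set `A'` is accepted with
probability at most `w ^ |A' \ A|` by Markov, since the ratio has mean one. Confusing only `i` of
the users would be the bottleneck if `I_i / i` could be smaller than `I_κ / κ`. It cannot: the
conditional entropy is concave in the number of unknown users (`condEntropy_concave`), hence `I_i ≥
(i / κ) I_κ`.

The minimum over preambles is at most the average, which carries achievability from random to fixed
preambles and the converse in the other direction. As `k = Θ(1)` eventually takes finitely many
positive values, statements for fixed `κ` suffice. -/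

/-! ### Complex Gaussian laws and the energy of a superposition. -/

instance isProbabilityMeasure_complexGaussian (v : ℝ) :
    IsProbabilityMeasure (complexGaussian v) := by
  refine Measure.isProbabilityMeasure_map (Measurable.aemeasurable ?_)
  exact Complex.measurableEquivRealProd.symm.measurable

lemma complexGaussian_eq (v : ℝ) : complexGaussian v =
    ((gaussianReal 0 (Real.toNNReal (v / 2))).prod (gaussianReal 0 (Real.toNNReal (v / 2)))).map
      Complex.measurableEquivRealProd.symm := rfl

lemma charFun_complexGaussian {v : ℝ} (hv : 0 ≤ v) (t : ℂ) :
    charFun (complexGaussian v) t = Complex.exp (-(v * ‖t‖ ^ 2 / 4 : ℝ)) := by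
  rw [charFun_apply, complexGaussian_eq, integral_map_equiv]
  have h : ∀ p : ℝ × ℝ, Complex.exp (inner ℝ (Complex.measurableEquivRealProd.symm p) t * Complex.I)
      = Complex.exp (inner ℝ p.1 t.re * Complex.I) * Complex.exp (inner ℝ p.2 t.im * Complex.I) := by
    intro p
    rw [← Complex.exp_add]
    congr 1
    simp [Complex.inner, Complex.measurableEquivRealProd_symm_apply]
    ring
  simp_rw [h]
  rw [integral_prod_mul (fun x : ℝ => Complex.exp (inner ℝ x t.re * Complex.I))
    (fun x : ℝ => Complex.exp (inner ℝ x t.im * Complex.I)), ← charFun_apply, ← charFun_apply,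
    charFun_gaussianReal, charFun_gaussianReal, ← Complex.exp_add]
  congr 1
  have : ‖t‖ ^ 2 = t.re * t.re + t.im * t.im := by
    rw [← Complex.normSq_eq_norm_sq, Complex.normSq_apply]
  rw [this, Real.coe_toNNReal _ (by positivity)]
  push_cast
  ring

/-- In polar coordinates the density is rotation invariant, and the radial integral has an explicit
primitive: the energy is exponential with mean `v`. -/
lemma complexGaussian_real_norm_sq_gt {v γ : ℝ} (hv : 0 < v) (hγ : 0 < γ) :
    (complexGaussian v).real {s | γ < ‖s‖ ^ 2} = Real.exp (-(γ / v)) := by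
  have hms : MeasurableSet {s : ℂ | γ < ‖s‖ ^ 2} :=
    measurableSet_lt measurable_const (by fun_prop)
  have hne : Real.toNNReal (v / 2) ≠ 0 := by
    simpa using hv
  set w := Real.toNNReal (v / 2) with hw
  have hwc : (w : ℝ) = v / 2 := Real.coe_toNNReal _ (by positivity)
  have hmeas : complexGaussian v {s | γ < ‖s‖ ^ 2} = ENNReal.ofReal (Real.exp (-(γ / v))) := by
    rw [complexGaussian_eq, ← hw, gaussianReal_of_var_ne_zero 0 hne,
      prod_withDensity (measurable_gaussianPDF _ _) (measurable_gaussianPDF _ _),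
      Measure.map_apply (MeasurableEquiv.measurable _) hms,
      withDensity_apply _ (MeasurableEquiv.measurable _ hms),
      ← lintegral_indicator (MeasurableEquiv.measurable _ hms), ← Measure.volume_eq_prod,
      ← lintegral_comp_polarCoord_symm]
    -- The trailing factor `1` is the angular part, so that the integral splits as a product; it
    -- contributes `2π`.
    have hpt : ∀ p ∈ polarCoord.target, ENNReal.ofReal p.1 •
        (Complex.measurableEquivRealProd.symm ⁻¹' {s : ℂ | γ < ‖s‖ ^ 2}).indicator
          (fun z : ℝ × ℝ => gaussianPDF 0 w z.1 * gaussianPDF 0 w z.2) (polarCoord.symm p) =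
        (Set.Ioi (Real.sqrt γ)).indicator
          (fun r => ENNReal.ofReal ((Real.pi * v)⁻¹ * (r * Real.exp (-(r ^ 2 / v))))) p.1 *
          (1 : ENNReal) := by
      intro p hp
      have hp0 : 0 < p.1 := hp.1
      have hiff : (polarCoord.symm p ∈
          (Complex.measurableEquivRealProd.symm ⁻¹' {s : ℂ | γ < ‖s‖ ^ 2})) ↔
          p.1 ∈ Set.Ioi (Real.sqrt γ) := by
        rw [Set.mem_preimage, Complex.measurableEquivRealProd_symm_polarCoord_symm_apply,
          Set.mem_ofPred_eq, Complex.norm_polarCoord_symm, sq_abs, Set.mem_Ioi,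
          Real.sqrt_lt' hp0]
      by_cases hc : p.1 ∈ Set.Ioi (Real.sqrt γ)
      · rw [Set.indicator_of_mem (hiff.2 hc), Set.indicator_of_mem hc, mul_one, gaussianPDF,
          gaussianPDF, ← ENNReal.ofReal_mul (gaussianPDFReal_nonneg _ _ _), smul_eq_mul,
          ← ENNReal.ofReal_mul hp0.le]
        congr 1
        rw [gaussianPDFReal, gaussianPDFReal, hwc, polarCoord_symm_apply]
        have h1 : (Real.sqrt (2 * Real.pi * (v / 2)))⁻¹ * (Real.sqrt (2 * Real.pi * (v / 2)))⁻¹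
            = (Real.pi * v)⁻¹ := by
          rw [← mul_inv, Real.mul_self_sqrt (by positivity)]
          congr 1; ring
        have h2 : Real.exp (-(p.1 * Real.cos p.2 - 0) ^ 2 / (2 * (v / 2))) *
            Real.exp (-(p.1 * Real.sin p.2 - 0) ^ 2 / (2 * (v / 2))) =
            Real.exp (-(p.1 ^ 2 / v)) := by
          rw [← Real.exp_add]
          congr 1
          have := Real.sin_sq_add_cos_sq p.2
          field_simp
          linear_combination (-p.1 ^ 2) * this
        calc _ = p.1 * (((Real.sqrt (2 * Real.pi * (v / 2)))⁻¹ *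
            (Real.sqrt (2 * Real.pi * (v / 2)))⁻¹) *
            (Real.exp (-(p.1 * Real.cos p.2 - 0) ^ 2 / (2 * (v / 2))) *
            Real.exp (-(p.1 * Real.sin p.2 - 0) ^ 2 / (2 * (v / 2))))) := by ring
          _ = _ := by rw [h1, h2]; ring
      · rw [Set.indicator_of_notMem (fun h => hc (hiff.1 h)), Set.indicator_of_notMem hc]
        simp
    rw [setLIntegral_congr_fun polarCoord.open_target.measurableSet hpt,
      polarCoord_target, Measure.volume_eq_prod, ← Measure.prod_restrict,
      lintegral_prod_mul (Measurable.aemeasurable (Measurable.indicator (by fun_prop)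
        measurableSet_Ioi)) aemeasurable_const,
      lintegral_one, Measure.restrict_apply_univ, Real.volume_Ioo,
      lintegral_indicator measurableSet_Ioi, Measure.restrict_restrict measurableSet_Ioi,
      Set.inter_eq_left.2 (Set.Ioi_subset_Ioi (Real.sqrt_nonneg γ))]
    have hder : ∀ x ∈ Set.Ici (Real.sqrt γ),
        HasDerivAt (fun r => -((2 * Real.pi)⁻¹ * Real.exp (-(r ^ 2 / v))))
        ((Real.pi * v)⁻¹ * (x * Real.exp (-(x ^ 2 / v)))) x := by
      intro x _
      have h := ((((((hasDerivAt_id x).pow 2).div_const v).neg).exp).const_mul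
        (2 * Real.pi)⁻¹).neg
      refine h.congr_deriv ?_
      have := Real.pi_pos
      simp
      field_simp
    have hnn : ∀ x ∈ Set.Ioi (Real.sqrt γ),
        0 ≤ (Real.pi * v)⁻¹ * (x * Real.exp (-(x ^ 2 / v))) := by
      intro x hx
      have : 0 < x := (Real.sqrt_nonneg γ).trans_lt hx
      have := Real.pi_pos
      positivity
    have hlim : Tendsto (fun r : ℝ => -((2 * Real.pi)⁻¹ * Real.exp (-(r ^ 2 / v)))) atTop
        (𝓝 0) := by
      have : Tendsto (fun r : ℝ => r ^ 2 / v) atTop atTop :=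
        (tendsto_pow_atTop two_ne_zero).atTop_div_const hv
      simpa using ((Real.tendsto_exp_neg_atTop_nhds_zero.comp this).const_mul
        (2 * Real.pi)⁻¹).neg
    rw [← ofReal_integral_eq_lintegral_ofReal (integrableOn_Ioi_deriv_of_nonneg' hder hnn hlim)
      ((ae_restrict_iff' measurableSet_Ioi).2 (ae_of_all _ hnn)),
      integral_Ioi_of_hasDerivAt_of_nonneg' hder hnn hlim, ← ENNReal.ofReal_mul]
    · congr 1
      rw [Real.sq_sqrt hγ.le]
      have := Real.pi_pos
      field_simp
      ring
    · have := Real.pi_pos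
      simp only [zero_sub, neg_neg]
      positivity
  rw [Measure.real, hmeas, ENNReal.toReal_ofReal (Real.exp_pos _).le]

/-- Characteristic functions of independent summands multiply, and those of centred Gaussians
multiply by adding variances. -/
lemma map_superposition_eq (σ σw : ℝ) {ℓ : ℕ} (A : Finset (Fin ℓ)) (a : Fin ℓ → ℝ) :
    ((Measure.pi fun _ : Fin ℓ => complexGaussian (σ ^ 2)).prod
      (complexGaussian (σw ^ 2))).map (fun p => (∑ i ∈ A, p.1 i * (a i : ℂ)) + p.2) =
    complexGaussian ((∑ i ∈ A, a i ^ 2) * σ ^ 2 + σw ^ 2) := by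
  set μ := Measure.pi fun _ : Fin ℓ => complexGaussian (σ ^ 2)
  set ν := complexGaussian (σw ^ 2)
  have hsum : Measurable (fun u : Fin ℓ → ℂ => ∑ i ∈ A, u i * (a i : ℂ)) := by fun_prop
  have hprob : IsProbabilityMeasure (μ.map (fun u : Fin ℓ → ℂ => ∑ i ∈ A, u i * (a i : ℂ))) :=
    Measure.isProbabilityMeasure_map hsum.aemeasurable
  have hfin : IsProbabilityMeasure ((μ.prod ν).map
      (fun p => (∑ i ∈ A, p.1 i * (a i : ℂ)) + p.2)) :=
    Measure.isProbabilityMeasure_map (Measurable.aemeasurable (by fun_prop))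
  apply Measure.ext_of_charFun
  have hmap : (μ.prod ν).map (fun p => (∑ i ∈ A, p.1 i * (a i : ℂ)) + p.2) =
      ((μ.map (fun u : Fin ℓ → ℂ => ∑ i ∈ A, u i * (a i : ℂ))).prod ν).map
        (fun p => p.1 + p.2) := by
    have : (μ.map (fun u : Fin ℓ → ℂ => ∑ i ∈ A, u i * (a i : ℂ))).prod ν =
        (μ.prod ν).map (Prod.map (fun u : Fin ℓ → ℂ => ∑ i ∈ A, u i * (a i : ℂ)) id) := by
      rw [← Measure.map_prod_map _ _ hsum measurable_id, Measure.map_id]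
    rw [this, Measure.map_map (by fun_prop) (by fun_prop)]
    rfl
  rw [hmap, charFun_map_add_prod_eq_mul]
  have hind : iIndepFun (fun (i : Fin ℓ) (u : Fin ℓ → ℂ) => a i • u i) μ :=
    iIndepFun_pi (X := fun i (z : ℂ) => a i • z) (fun i => by fun_prop)
  have hs := iIndepFun.charFun_map_fun_finsetSum_eq_prod (s := A) (P := μ)
    (X := fun (i : Fin ℓ) (u : Fin ℓ → ℂ) => a i • u i)
    (fun i _ => ((measurable_pi_apply i).const_smul (a i)).aemeasurable) (hind.restrict _)
  have hf : (fun u : Fin ℓ → ℂ => ∑ i ∈ A, u i * (a i : ℂ)) =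
      fun u => ∑ i ∈ A, a i • u i := by
    ext u
    refine Finset.sum_congr rfl fun i _ => ?_
    rw [Complex.real_smul, mul_comm]
  rw [hf, hs]
  ext t
  have hi : ∀ i, charFun (μ.map (fun u : Fin ℓ → ℂ => a i • u i)) t =
      Complex.exp (-(σ ^ 2 * (a i ^ 2 * ‖t‖ ^ 2) / 4 : ℝ)) := by
    intro i
    rw [charFun_map_smul_comp (f := fun u : Fin ℓ → ℂ => u i) (measurable_pi_apply i).aemeasurable,
      (measurePreserving_eval (fun _ : Fin ℓ => complexGaussian (σ ^ 2)) i).map_eq,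
      charFun_complexGaussian (sq_nonneg _), norm_smul, mul_pow, Real.norm_eq_abs, sq_abs]
  rw [Pi.mul_apply, Finset.prod_apply, Finset.prod_congr rfl (fun i _ => hi i),
    charFun_complexGaussian (sq_nonneg _), charFun_complexGaussian (by positivity),
    ← Complex.exp_sum, ← Complex.exp_add]
  congr 1
  push_cast
  rw [Finset.sum_neg_distrib, Finset.sum_mul, add_mul, add_div, neg_add, Finset.sum_mul,
    Finset.sum_div]
  congr 2
  refine Finset.sum_congr rfl fun i _ => ?_
  ring

/-! ### Reduction to a finite memoryless channel. -/

/-- The mass function of a Bernoulli law. -/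
def bern (p : ℝ) (b : Bool) : ℝ := if b then p else 1 - p

/-- The number of users in `A` that are `On` in the column `c`. -/
def onCount {ℓ : ℕ} (A : Finset (Fin ℓ)) (c : Fin ℓ → Bool) : ℕ := (A.filter fun i => c i).card

lemma measurable_received_coord (P : ℝ) {ℓ : ℕ} (A : Finset (Fin ℓ)) (c : Fin ℓ → Bool) :
    Measurable (fun p : (Fin ℓ → ℂ) × ℂ => (∑ i ∈ A, p.1 i * (ook P (c i) : ℂ)) + p.2) := by
  fun_prop

lemma sum_ook_sq {P : ℝ} (hP : 0 < P) {ℓ : ℕ} (A : Finset (Fin ℓ)) (c : Fin ℓ → Bool) :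
    ∑ i ∈ A, ook P (c i) ^ 2 = onCount A c * P := by
  have : ∀ i ∈ A, ook P (c i) ^ 2 = if c i then P else 0 := by
    intro i _
    by_cases h : c i <;> simp [ook, h, Real.sq_sqrt hP.le]
  rw [Finset.sum_congr rfl this, ← Finset.sum_filter, Finset.sum_const, nsmul_eq_mul, onCount]

lemma slot_detection_prob {P σ σw γ : ℝ} (hP : 0 < P) (hσw : 0 < σw) (hγ : 0 < γ) {ℓ : ℕ}
    (A : Finset (Fin ℓ)) (c : Fin ℓ → Bool) (b : Bool) :
    ((Measure.pi fun _ : Fin ℓ => complexGaussian (σ ^ 2)).prod (complexGaussian (σw ^ 2))).real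
      {p | decide (γ < ‖(∑ i ∈ A, p.1 i * (ook P (c i) : ℂ)) + p.2‖ ^ 2) = b} =
    bern (onProb P σ σw γ (onCount A c)) b := by
  set m := (Measure.pi fun _ : Fin ℓ => complexGaussian (σ ^ 2)).prod (complexGaussian (σw ^ 2))
  have hmeas := measurable_received_coord P A c
  have hset : MeasurableSet {s : ℂ | γ < ‖s‖ ^ 2} := measurableSet_lt measurable_const (by fun_prop)
  have htrue : m.real ((fun p : (Fin ℓ → ℂ) × ℂ =>
      (∑ i ∈ A, p.1 i * (ook P (c i) : ℂ)) + p.2) ⁻¹' {s : ℂ | γ < ‖s‖ ^ 2}) =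
      onProb P σ σw γ (onCount A c) := by
    rw [← map_measureReal_apply hmeas hset, map_superposition_eq σ σw A fun i => ook P (c i),
      sum_ook_sq hP, complexGaussian_real_norm_sq_gt (by positivity) hγ, onProb]
    ring_nf
  cases b
  · have : {p : (Fin ℓ → ℂ) × ℂ |
        decide (γ < ‖(∑ i ∈ A, p.1 i * (ook P (c i) : ℂ)) + p.2‖ ^ 2) = false} =
        ((fun p : (Fin ℓ → ℂ) × ℂ =>
          (∑ i ∈ A, p.1 i * (ook P (c i) : ℂ)) + p.2) ⁻¹' {s : ℂ | γ < ‖s‖ ^ 2})ᶜ := by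
      ext p; simp
    rw [this, probReal_compl_eq_one_sub (hmeas hset), htrue]
    simp [bern]
  · simp only [decide_eq_true_eq, bern, if_true]
    exact htrue

lemma detectorOutput_law {P σ σw γ : ℝ} (hP : 0 < P) (hσw : 0 < σw) (hγ : 0 < γ)
    {ℓ n : ℕ} (x : Preambles ℓ n) (A : Finset (Fin ℓ)) (z : Fin n → Bool) :
    (channelLaw σ σw ℓ n).real (detectorOutput P γ x A ⁻¹' {z}) =
      ∏ t, bern (onProb P σ σw γ (onCount A fun i => x i t)) (z t) := by
  have hset : detectorOutput P γ x A ⁻¹' {z} = Set.pi Set.univ fun t =>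
      {p : (Fin ℓ → ℂ) × ℂ |
        decide (γ < ‖(∑ i ∈ A, p.1 i * (ook P (x i t) : ℂ)) + p.2‖ ^ 2) = z t} := by
    ext ω
    simp only [Set.mem_preimage, Set.mem_singleton_iff, Set.mem_pi, Set.mem_univ, true_imp_iff,
      funext_iff, detectorOutput, received, Set.mem_ofPred_eq]
    refine forall_congr' fun t => ?_
    exact iff_of_eq (by congr)
  rw [hset, channelLaw, Measure.real, Measure.pi_pi, ENNReal.toReal_prod]
  exact Finset.prod_congr rfl fun t _ => slot_detection_prob hP hσw hγ A (fun i => x i t) (z t)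

lemma measurable_detectorOutput (P γ : ℝ) {ℓ n : ℕ} (x : Preambles ℓ n) (A : Finset (Fin ℓ)) :
    Measurable (detectorOutput P γ x A) := by
  refine measurable_pi_lambda _ fun t => ?_
  refine measurable_to_bool ?_
  have h : MeasurableSet {ω | γ < ‖received P x A ω t‖ ^ 2} := by
    refine measurableSet_lt measurable_const ?_
    unfold received
    fun_prop
  convert! h using 1
  ext ω
  simp [detectorOutput]

/-- The channel measure enters the error probability only through the finite law of the output;
everything later is a finite sum. -/
lemma errorProb_eq {P σ σw γ : ℝ} (hP : 0 < P) (hσw : 0 < σw) (hγ : 0 < γ) {ℓ n k : ℕ}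
    (x : Preambles ℓ n) (g : Detector ℓ n k) :
    errorProb P σ σw γ x g = (1 / (ℓ.choose k : ℝ)) *
      ∑ A ∈ (Finset.univ : Finset (Fin ℓ)).powersetCard k,
        ∑ z : Fin n → Bool with g.estimate z ≠ A,
          ∏ t, bern (onProb P σ σw γ (onCount A fun i => x i t)) (z t) := by
  rw [errorProb]
  congr 1
  refine Finset.sum_congr rfl fun A _ => ?_
  have : IsProbabilityMeasure (channelLaw σ σw ℓ n) := by
    unfold channelLaw; infer_instance
  have hset : {ω | g.estimate (detectorOutput P γ x A ω) ≠ A} =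
      detectorOutput P γ x A ⁻¹' ↑(Finset.univ.filter fun z => g.estimate z ≠ A) := by
    ext ω; simp
  rw [hset, ← sum_measureReal_preimage_singleton _
    fun z _ => measurable_detectorOutput P γ x A (measurableSet_singleton z)]
  exact Finset.sum_congr rfl fun z _ => detectorOutput_law hP hσw hγ x A z

/-! ### Binomial expectations as powers of an averaging operator. -/

/-- Averaging over one more `Bern(q)` summand: `f ↦ E[f(· + B)]`, `B ∼ Bern(q)`. -/
def binStep (q : ℝ) : Module.End ℝ (ℕ → ℝ) where
  toFun f v := (1 - q) * f v + q * f (v + 1)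
  map_add' f g := by ext v; simp only [Pi.add_apply]; ring
  map_smul' c f := by ext v; simp only [Pi.smul_apply, smul_eq_mul, RingHom.id_apply]; ring

lemma binStep_apply (q : ℝ) (f : ℕ → ℝ) (v : ℕ) :
    binStep q f v = (1 - q) * f v + q * f (v + 1) := rfl

lemma binStep_pow_succ_apply (q : ℝ) (n : ℕ) (f : ℕ → ℝ) (v : ℕ) :
    (binStep q ^ (n + 1)) f v = (1 - q) * (binStep q ^ n) f v + q * (binStep q ^ n) f (v + 1) := by
  rw [pow_succ', Module.End.mul_apply, binStep_apply]

/-- `binStep q` is a combination of the shift and the identity, so the binomial theorem for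
commuting operators applies. In operator form, averaging over further users is composition. -/
lemma binStep_pow_apply (q : ℝ) (n : ℕ) (f : ℕ → ℝ) (v : ℕ) :
    (binStep q ^ n) f v = binomialExp n q fun j => f (v + j) := by
  let S : Module.End ℝ (ℕ → ℝ) :=
    { toFun := fun f v => f (v + 1), map_add' := fun _ _ => rfl, map_smul' := fun _ _ => rfl }
  have hS : ∀ m (f : ℕ → ℝ) (v : ℕ), (S ^ m) f v = f (v + m) := by
    intro m
    induction m with
    | zero => intro f v; simp
    | succ m ih =>
      intro f v
      rw [pow_succ, Module.End.mul_apply, ih]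
      rfl
  have hT : binStep q = q • S + (1 - q) • (1 : Module.End ℝ (ℕ → ℝ)) := by
    ext f v
    simp [binStep_apply, S]
    ring
  have hc : Commute (q • S) ((1 - q) • (1 : Module.End ℝ (ℕ → ℝ))) :=
    ((Commute.one_right S).smul_left q).smul_right (1 - q)
  rw [hT, hc.add_pow, LinearMap.sum_apply, Finset.sum_apply, binomialExp]
  refine Finset.sum_congr rfl fun m _ => ?_
  rw [smul_pow, smul_pow, one_pow, mul_assoc, Module.End.mul_apply]
  simp only [LinearMap.smul_apply, Pi.smul_apply, hS, smul_eq_mul, Module.End.mul_apply,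
    Module.End.one_apply, Module.End.natCast_apply]
  simp
  ring

lemma binomialExp_eq (κ : ℕ) (q : ℝ) (f : ℕ → ℝ) :
    binomialExp κ q f = (binStep q ^ κ) f 0 := by
  simp [binStep_pow_apply]

lemma binStep_pow_const (q : ℝ) (n : ℕ) (a : ℝ) (v : ℕ) :
    (binStep q ^ n) (fun _ => a) v = a := by
  induction n generalizing v with
  | zero => simp
  | succ n ih => rw [binStep_pow_succ_apply, ih, ih]; ring

lemma binStep_pow_mono {q : ℝ} (hq : q ∈ Set.Icc (0 : ℝ) 1) (n : ℕ) {f g : ℕ → ℝ}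
    (hfg : ∀ v, f v ≤ g v) (v : ℕ) : (binStep q ^ n) f v ≤ (binStep q ^ n) g v := by
  induction n generalizing v with
  | zero => simpa using hfg v
  | succ n ih =>
    rw [binStep_pow_succ_apply, binStep_pow_succ_apply]
    exact add_le_add (mul_le_mul_of_nonneg_left (ih v) (by linarith [hq.2]))
      (mul_le_mul_of_nonneg_left (ih _) hq.1)

lemma convex_comb_mem_Ioo {q a b : ℝ} (hq : q ∈ Set.Icc (0 : ℝ) 1) (ha : a ∈ Set.Ioo (0 : ℝ) 1)
    (hb : b ∈ Set.Ioo (0 : ℝ) 1) : (1 - q) * a + q * b ∈ Set.Ioo (0 : ℝ) 1 := by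
  have := (convex_Ioo (0 : ℝ) 1) ha hb (by linarith [hq.2] : 0 ≤ 1 - q) hq.1 (by ring)
  simpa using this

lemma binStep_pow_mem_Ioo {q : ℝ} (hq : q ∈ Set.Icc (0 : ℝ) 1) (n : ℕ) {f : ℕ → ℝ}
    (hf : ∀ v, f v ∈ Set.Ioo (0 : ℝ) 1) (v : ℕ) : (binStep q ^ n) f v ∈ Set.Ioo (0 : ℝ) 1 := by
  induction n generalizing v with
  | zero => simpa using hf v
  | succ n ih =>
    rw [binStep_pow_succ_apply]
    exact convex_comb_mem_Ioo hq (ih _) (ih _)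

/-! ### Concavity of the conditional entropy in the number of unknown users. -/

/-- The tangent inequality behind the log-sum inequality. -/
lemma mul_log_sub_log_ge {a b A B : ℝ} (ha : 0 < a) (hb : 0 < b) (hA : 0 < A) (hB : 0 < B) :
    a * (Real.log A - Real.log B) + (a - b * A / B) ≤ a * (Real.log a - Real.log b) := by
  have h := Real.log_le_sub_one_of_pos (show 0 < b * A / (a * B) by positivity)
  rw [Real.log_div (by positivity) (by positivity), Real.log_mul hb.ne' hA.ne',
    Real.log_mul ha.ne' hB.ne'] at h
  have h2 := mul_le_mul_of_nonneg_left h ha.le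
  have h3 : a * (b * A / (a * B) - 1) = b * A / B - a := by field_simp
  linarith

/-- Joint convexity of `(a, c) ↦ a log (a / c)`. -/
lemma mul_log_sub_log_convex {q a b c d : ℝ} (hq : q ∈ Set.Icc (0 : ℝ) 1) (ha : 0 < a) (hb : 0 < b)
    (hc : 0 < c) (hd : 0 < d) :
    ((1 - q) * a + q * b) *
        (Real.log ((1 - q) * a + q * b) - Real.log ((1 - q) * c + q * d)) ≤
      (1 - q) * (a * (Real.log a - Real.log c)) + q * (b * (Real.log b - Real.log d)) := by
  have hpos : ∀ x y : ℝ, 0 < x → 0 < y → 0 < (1 - q) * x + q * y := by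
    intro x y hx hy
    have := (convex_Ioi (0 : ℝ)) hx hy (by linarith [hq.2] : 0 ≤ 1 - q) hq.1 (by ring)
    simpa using this
  have hA := hpos a b ha hb
  have hB := hpos c d hc hd
  have h1 := mul_le_mul_of_nonneg_left (mul_log_sub_log_ge ha hc hA hB)
    (by linarith [hq.2] : 0 ≤ 1 - q)
  have h2 := mul_le_mul_of_nonneg_left (mul_log_sub_log_ge hb hd hA hB) hq.1
  set A := (1 - q) * a + q * b with hAd
  set B := (1 - q) * c + q * d with hBd
  have h3 : (1 - q) * (a - c * A / B) + q * (b - d * A / B) = 0 := by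
    have : (1 - q) * (a - c * A / B) + q * (b - d * A / B) = A - B * A / B := by
      rw [hAd, hBd]; ring
    rw [this, mul_div_assoc, mul_div_cancel₀ _ hB.ne', sub_self]
  have h4 : A * (Real.log A - Real.log B) =
      (1 - q) * (a * (Real.log A - Real.log B)) + q * (b * (Real.log A - Real.log B)) := by
    rw [hAd]; ring
  linarith

/-- Conditioning on the second of two independent inputs does not decrease the information that
the first one gives about the output. -/
lemma binEntropy_submodular {q a b c : ℝ} (hq : q ∈ Set.Icc (0 : ℝ) 1)
    (ha : a ∈ Set.Ioo (0 : ℝ) 1) (hb : b ∈ Set.Ioo (0 : ℝ) 1) (hc : c ∈ Set.Ioo (0 : ℝ) 1) :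
    (1 - q) * ((1 - q) * Real.binEntropy a + q * Real.binEntropy b) +
      q * ((1 - q) * Real.binEntropy b + q * Real.binEntropy c) +
      Real.binEntropy ((1 - q) * ((1 - q) * a + q * b) + q * ((1 - q) * b + q * c)) ≤
    2 * ((1 - q) * Real.binEntropy ((1 - q) * a + q * b) +
      q * Real.binEntropy ((1 - q) * b + q * c)) := by
  have hx := convex_comb_mem_Ioo hq ha hb
  have hy := convex_comb_mem_Ioo hq hb hc
  have hz := convex_comb_mem_Ioo hq hx hy
  have ex : 1 - ((1 - q) * a + q * b) = (1 - q) * (1 - a) + q * (1 - b) := by ring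
  have ey : 1 - ((1 - q) * b + q * c) = (1 - q) * (1 - b) + q * (1 - c) := by ring
  have key : ∀ a b c : ℝ, 0 < a → 0 < b → 0 < c →
      ((1 - q) * ((1 - q) * a + q * b) + q * ((1 - q) * b + q * c)) *
        -Real.log ((1 - q) * ((1 - q) * a + q * b) + q * ((1 - q) * b + q * c)) -
      2 * ((1 - q) * (((1 - q) * a + q * b) * -Real.log ((1 - q) * a + q * b)) +
        q * (((1 - q) * b + q * c) * -Real.log ((1 - q) * b + q * c))) ≤
      -((1 - q) * ((1 - q) * (a * -Real.log a) + q * (b * -Real.log b)) +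
        q * ((1 - q) * (b * -Real.log b) + q * (c * -Real.log c))) := by
    intro a b c ha hb hc
    have hpos : ∀ x y : ℝ, 0 < x → 0 < y → 0 < (1 - q) * x + q * y := by
      intro x y hx hy
      have := (convex_Ioi (0 : ℝ)) hx hy (by linarith [hq.2] : 0 ≤ 1 - q) hq.1 (by ring)
      simpa using this
    have hx := hpos a b ha hb
    have hy := hpos b c hb hc
    -- The pairs `(a, b)` and `(b, c)` are compared with the same reference pair of one-step
    -- averages, whose own average is the overall mean. Since `b` occupies both mixed positions, the
    -- cross terms recombine into the two one-step averages.
    have h1 := mul_le_mul_of_nonneg_left (mul_log_sub_log_convex hq ha hb hx hy)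
      (by linarith [hq.2] : 0 ≤ 1 - q)
    have h2 := mul_le_mul_of_nonneg_left (mul_log_sub_log_convex hq hb hc hx hy) hq.1
    nlinarith [h1, h2]
  have h1 := key a b c ha.1 hb.1 hc.1
  have h2 := key (1 - a) (1 - b) (1 - c) (by linarith [ha.2]) (by linarith [hb.2])
    (by linarith [hc.2])
  have ez : 1 - ((1 - q) * ((1 - q) * a + q * b) + q * ((1 - q) * b + q * c)) =
    (1 - q) * ((1 - q) * (1 - a) + q * (1 - b)) + q * ((1 - q) * (1 - b) + q * (1 - c)) := by ring
  simp only [Real.binEntropy, Real.log_inv, ez, ex, ey]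
  linarith

/-- The entropy (in nats) of the output given all but `j` of `κ` users, where `p v` is the
probability of the output `1` when `v` users are on. -/
def condEntropy (p : ℕ → ℝ) (q : ℝ) (κ j : ℕ) : ℝ :=
  (binStep q ^ (κ - j)) (fun v => Real.binEntropy ((binStep q ^ j) p v)) 0

/-- The three entropies share an outer average over `κ - j - 2` users; as this average is monotone,
only the two-user inequality `binEntropy_submodular` remains. -/
lemma condEntropy_concave {p : ℕ → ℝ} (hp : ∀ v, p v ∈ Set.Ioo (0 : ℝ) 1) {q : ℝ}
    (hq : q ∈ Set.Icc (0 : ℝ) 1) {κ j : ℕ} (hj : j + 2 ≤ κ) :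
    condEntropy p q κ j + condEntropy p q κ (j + 2) ≤ 2 * condEntropy p q κ (j + 1) := by
  obtain ⟨m, rfl⟩ := Nat.exists_eq_add_of_le hj
  set g := (binStep q ^ j) p with hg
  have hgm : ∀ v, g v ∈ Set.Ioo (0 : ℝ) 1 := binStep_pow_mem_Ioo hq j hp
  have e1 : (binStep q ^ (j + 1)) p = binStep q g := by rw [pow_succ', Module.End.mul_apply]
  have e2 : (binStep q ^ (j + 2)) p = binStep q (binStep q g) := by
    rw [pow_succ', Module.End.mul_apply, e1]
  have d0 : j + 2 + m - j = m + 1 + 1 := by omega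
  have d1 : j + 2 + m - (j + 1) = m + 1 := by omega
  have d2 : j + 2 + m - (j + 2) = m := by omega
  rw [condEntropy, condEntropy, condEntropy, d0, d1, d2, e1, e2, ← hg, pow_succ _ (m + 1),
    pow_succ _ m, Module.End.mul_apply, Module.End.mul_apply, Module.End.mul_apply,
    ← smul_eq_mul, ← Pi.smul_apply, ← Pi.add_apply, ← map_add, ← map_smul]
  refine binStep_pow_mono hq m (fun v => ?_) 0
  simp only [Pi.add_apply, Pi.smul_apply, smul_eq_mul, binStep_apply]
  exact binEntropy_submodular hq (hgm v) (hgm (v + 1)) (hgm (v + 1 + 1))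

/-- Chord slopes from `0` of a concave sequence decrease. Applied to `condEntropy`, any `i` users
carry at least the share `i / κ` of the total information. -/
lemma concave_seq_average {F : ℕ → ℝ} {κ : ℕ}
    (hF : ∀ j, j + 2 ≤ κ → F j + F (j + 2) ≤ 2 * F (j + 1)) {i : ℕ} (hi : 1 ≤ i) (hik : i ≤ κ) :
    (i : ℝ) * (F κ - F 0) ≤ κ * (F i - F 0) := by
  have h1 : ∀ m, m + 1 ≤ κ → (m : ℝ) * (F (m + 1) - F m) ≤ F m - F 0 := by
    intro m
    induction m with
    | zero => intro _; simp
    | succ m ih =>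
      intro hm
      have h := ih (by omega)
      have h2 := hF m (by omega)
      have h3 : (m : ℝ) * (F (m + 2) - F (m + 1)) ≤ m * (F (m + 1) - F m) :=
        mul_le_mul_of_nonneg_left (by linarith) (Nat.cast_nonneg m)
      push_cast
      linarith
  have h2 : ∀ m, i ≤ m → m ≤ κ → (i : ℝ) * (F m - F 0) ≤ m * (F i - F 0) := by
    intro m hm
    induction m, hm using Nat.le_induction with
    | base => intro _; exact le_rfl
    | succ m hm ih =>
      intro hmk
      have hm0 : (0 : ℝ) < m := by exact_mod_cast (by omega : 0 < m)
      have a := mul_le_mul_of_nonneg_left (ih (by omega)) (by positivity : (0 : ℝ) ≤ m + 1)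
      have b := mul_le_mul_of_nonneg_left (h1 m hmk) (Nat.cast_nonneg (α := ℝ) i)
      refine le_of_mul_le_mul_left ?_ hm0
      push_cast
      linarith
  exact h2 κ hik le_rfl

/-! ### The maximal rate is attained and positive. -/

lemma h_eq (x : ℝ) : h x = Real.binEntropy x / Real.log 2 := by
  rw [h, Real.binEntropy, Real.logb, Real.logb, Real.log_inv, Real.log_inv]
  ring

lemma onProb_mem_Ioo {P σ σw γ : ℝ} (hP : 0 < P) (hσw : 0 < σw) (hγ : 0 < γ) (v : ℕ) :
    onProb P σ σw γ v ∈ Set.Ioo (0 : ℝ) 1 := by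
  refine ⟨Real.exp_pos _, ?_⟩
  rw [onProb, Real.exp_lt_one_iff, neg_lt_zero]
  positivity

/-- The rate is a mutual information: output entropy with all users unknown minus that with all
known, converted from nats to bits. -/
lemma rate_eq_condEntropy (P σ σw : ℝ) (κ : ℕ) (γ q : ℝ) :
    rate P σ σw κ γ q =
      (condEntropy (onProb P σ σw γ) q κ κ - condEntropy (onProb P σ σw γ) q κ 0) /
        Real.log 2 := by
  have : (fun v => h (onProb P σ σw γ v)) =
      (Real.log 2)⁻¹ • fun v => Real.binEntropy (onProb P σ σw γ v) := by
    ext v; simp [h_eq]; ring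
  rw [rate, binomialExp_eq, binomialExp_eq, condEntropy, condEntropy, this, map_smul, h_eq]
  simp
  ring

lemma binomialExp_const (κ : ℕ) (q a : ℝ) : binomialExp κ q (fun _ => a) = a := by
  rw [binomialExp_eq, binStep_pow_const]

/-- Strict Jensen: all binomial weights are positive at `q = 1 / 2`, and zero and one On users give
different output probabilities. -/
lemma rate_pos {P σ σw : ℝ} (hP : 0 < P) (hσ : 0 < σ) (hσw : 0 < σw) {κ : ℕ} (hκ : 1 ≤ κ) :
    0 < rate P σ σw κ 1 (1 / 2) := by
  have hp := onProb_mem_Ioo (σ := σ) hP hσw one_pos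
  rw [rate, h_eq]
  have hs := Real.strictConcave_binEntropy.lt_map_sum (t := Finset.range (κ + 1))
    (w := fun v => (κ.choose v : ℝ) * (1 / 2) ^ v * (1 - 1 / 2) ^ (κ - v))
    (p := onProb P σ σw 1) (fun v hv => ?_) ?_ (fun v _ => ⟨(hp v).1.le, (hp v).2.le⟩)
    ⟨0, by simp, 1, by simp; omega, ?_⟩
  · have e : binomialExp κ (1 / 2) (fun v => h (onProb P σ σw 1 v)) =
        (∑ v ∈ Finset.range (κ + 1), ((κ.choose v : ℝ) * (1 / 2) ^ v * (1 - 1 / 2) ^ (κ - v)) •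
          Real.binEntropy (onProb P σ σw 1 v)) / Real.log 2 := by
      rw [binomialExp, Finset.sum_div]
      refine Finset.sum_congr rfl fun v _ => ?_
      rw [h_eq, smul_eq_mul]
      ring
    rw [e, ← sub_div]
    exact div_pos (sub_pos.2 hs) (Real.log_pos one_lt_two)
  · have : v ≤ κ := by simpa [Nat.lt_succ_iff] using hv
    have := Nat.choose_pos this
    have h2 : (0 : ℝ) < 1 - 1 / 2 := by norm_num
    positivity
  · simpa [binomialExp] using binomialExp_const κ (1 / 2) 1
  · refine ne_of_lt ?_
    rw [onProb, onProb, Real.exp_lt_exp, neg_lt_neg_iff]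
    push_cast
    refine div_lt_div_of_pos_left one_pos (by positivity) ?_
    nlinarith [mul_pos (pow_pos hσ 2) hP]

/-- The substitution `u = exp (-γ)` extends the rate continuously to the compact square. On the
edges `u = 0` and `u = 1` the output is deterministic and the rate vanishes, so a positive maximum
comes from a genuine threshold. -/
lemma exists_max_rate {P σ σw : ℝ} (hP : 0 < P) (hσ : 0 < σ) (hσw : 0 < σw) {κ : ℕ}
    (hκ : 1 ≤ κ) : ∃ γ q : ℝ, 0 < γ ∧ q ∈ Set.Icc (0 : ℝ) 1 ∧
      ∀ γ' q' : ℝ, 0 < γ' → q' ∈ Set.Icc (0 : ℝ) 1 →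
        rate P σ σw κ γ' q' ≤ rate P σ σw κ γ q := by
  let α : ℕ → ℝ := fun v => 1 / (v * σ ^ 2 * P + σw ^ 2)
  have hα : ∀ v, 0 < α v := fun v => by positivity
  let G : ℝ × ℝ → ℝ := fun z => h (binomialExp κ z.2 fun v => z.1 ^ α v) -
    binomialExp κ z.2 fun v => h (z.1 ^ α v)
  have hh : Continuous h := by
    have : h = fun x => Real.binEntropy x / Real.log 2 := funext h_eq
    rw [this]
    exact Real.binEntropy_continuous.div_const _
  have hpow : ∀ v, Continuous fun z : ℝ × ℝ => z.1 ^ α v := fun v =>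
    (Real.continuous_rpow_const (hα v).le).comp continuous_fst
  have hG : Continuous G := by
    unfold G binomialExp
    refine Continuous.sub (hh.comp (continuous_finsetSum _ fun v _ => ?_))
      (continuous_finsetSum _ fun v _ => ?_)
    · exact Continuous.mul (by fun_prop) (hpow v)
    · exact Continuous.mul (by fun_prop) (hh.comp (hpow v))
  have hGr : ∀ γ q, G (Real.exp (-γ), q) = rate P σ σw κ γ q := by
    intro γ q
    have : ∀ v, Real.exp (-γ) ^ α v = onProb P σ σw γ v := by
      intro v
      rw [onProb, ← Real.exp_mul]
      simp only [α]
      congr 1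
      ring
    simp only [G, this, rate]
  obtain ⟨⟨u, q⟩, ⟨hu, hq⟩, hmax⟩ := (isCompact_Icc.prod isCompact_Icc :
    IsCompact (Set.Icc (0 : ℝ) 1 ×ˢ Set.Icc (0 : ℝ) 1)).exists_isMaxOn
      ⟨(0, 0), by simp⟩ hG.continuousOn
  have hmax' : ∀ γ' q' : ℝ, 0 < γ' → q' ∈ Set.Icc (0 : ℝ) 1 →
      rate P σ σw κ γ' q' ≤ G (u, q) := by
    intro γ' q' hγ' hq'
    rw [← hGr]
    exact hmax ⟨⟨(Real.exp_pos _).le, Real.exp_le_one_iff.2 (by linarith)⟩, hq'⟩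
  have hpos : 0 < G (u, q) := (rate_pos hP hσ hσw hκ).trans_le
    (hmax' 1 (1 / 2) one_pos (by norm_num))
  have hu0 : u ≠ 0 := by
    rintro rfl
    have : G (0, q) = 0 := by
      simp only [G, Real.zero_rpow (hα _).ne', binomialExp_const]
      ring
    exact hpos.ne' this
  have hu1 : u ≠ 1 := by
    rintro rfl
    have : G (1, q) = 0 := by
      simp only [G, Real.one_rpow, binomialExp_const]
      ring
    exact hpos.ne' this
  have hu0' : 0 < u := lt_of_le_of_ne hu.1 hu0.symm
  refine ⟨-Real.log u, q, ?_, hq, ?_⟩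
  · have := Real.log_neg hu0' (lt_of_le_of_ne hu.2 hu1)
    linarith
  · rw [← hGr, neg_neg, Real.exp_log hu0']
    exact hmax'

lemma isGreatest_maxRate {P σ σw : ℝ} (hP : 0 < P) (hσ : 0 < σ) (hσw : 0 < σw) {κ : ℕ}
    (hκ : 1 ≤ κ) : IsGreatest (rateSet P σ σw κ) (maxRate P σ σw κ) := by
  obtain ⟨γ, q, hγ, hq, hmax⟩ := exists_max_rate hP hσ hσw hκ
  have hg : IsGreatest (rateSet P σ σw κ) (rate P σ σw κ γ q) := by
    refine ⟨⟨γ, q, hγ, hq, rfl⟩, ?_⟩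
    rintro r ⟨γ', q', hγ', hq', rfl⟩
    exact hmax γ' q' hγ' hq'
  rw [maxRate, hg.csSup_eq]
  exact hg

lemma maxRate_pos {P σ σw : ℝ} (hP : 0 < P) (hσ : 0 < σ) (hσw : 0 < σw) {κ : ℕ}
    (hκ : 1 ≤ κ) : 0 < maxRate P σ σw κ :=
  (rate_pos hP hσ hσw hκ).trans_le ((isGreatest_maxRate hP hσ hσw hκ).2
    ⟨1, 1 / 2, one_pos, by norm_num, rfl⟩)

/-! ### Converse: sampling with replacement and relative entropy. -/

lemma bern_pos {p : ℝ} (hp : p ∈ Set.Ioo (0 : ℝ) 1) (b : Bool) : 0 < bern p b := by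
  cases b <;> simp [bern, hp.1, hp.2]

lemma sum_bern (p : ℝ) : ∑ b, bern p b = 1 := by simp [bern]

lemma sum_pi_prod {ι α : Type*} [Fintype ι] [DecidableEq ι] [Fintype α] (w : ι → α → ℝ) :
    ∑ z : ι → α, ∏ s, w s (z s) = ∏ s, ∑ b, w s b := by
  rw [Finset.prod_univ_sum, Fintype.piFinset_univ]

lemma sum_pi_prod_mul_coord {ι α : Type*} [Fintype ι] [DecidableEq ι] [Fintype α]
    {w : ι → α → ℝ} (hw : ∀ s, ∑ b, w s b = 1) (t : ι) (F : α → ℝ) :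
    ∑ z : ι → α, (∏ s, w s (z s)) * F (z t) = ∑ b, w t b * F b := by
  have h : ∀ z : ι → α, (∏ s, w s (z s)) * F (z t) =
      ∏ s, (w s (z s) * if s = t then F (z s) else 1) := by
    intro z
    rw [Finset.prod_mul_distrib, Finset.prod_ite_eq' Finset.univ t fun s => F (z s)]
    simp
  rw [Finset.sum_congr rfl fun z _ => h z,
    sum_pi_prod fun s b => w s b * if s = t then F b else 1,
    Finset.prod_eq_single_of_mem t (Finset.mem_univ t)]
  · simp
  · intro s _ hs
    simpa [hs] using hw s

lemma sum_prod_bern {n : ℕ} (a : Fin n → ℝ) : ∑ z : Fin n → Bool, ∏ t, bern (a t) (z t) = 1 := by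
  rw [sum_pi_prod fun t b => bern (a t) b]
  exact Finset.prod_eq_one fun t _ => sum_bern (a t)

/-- Sampling `κ` users with replacement, the number of users that are on is binomial. -/
lemma sum_with_replacement {ℓ : ℕ} (hℓ : 0 < ℓ) (c : Fin ℓ → Bool) (φ : ℕ → ℝ) (κ v : ℕ) :
    ∑ f : Fin κ → Fin ℓ, φ (v + ∑ j, if c (f j) then 1 else 0) =
      (ℓ : ℝ) ^ κ * (binStep (onCount Finset.univ c / ℓ) ^ κ) φ v := by
  have hℓ' : (ℓ : ℝ) ≠ 0 := by exact_mod_cast hℓ.ne'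
  induction κ generalizing v with
  | zero => simp
  | succ κ ih =>
    rw [← (Fin.consEquiv fun _ : Fin (κ + 1) => Fin ℓ).sum_comp, Fintype.sum_prod_type]
    have h1 : ∀ a : Fin ℓ, (∑ f : Fin κ → Fin ℓ,
        φ (v + ∑ j, if c (Fin.consEquiv (fun _ : Fin (κ + 1) => Fin ℓ) (a, f) j) then 1 else 0)) =
        (ℓ : ℝ) ^ κ * (if c a then (binStep (onCount Finset.univ c / ℓ) ^ κ) φ (v + 1)
          else (binStep (onCount Finset.univ c / ℓ) ^ κ) φ v) := by
      intro a
      have : ∀ f : Fin κ → Fin ℓ,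
          (∑ j, if c (Fin.consEquiv (fun _ : Fin (κ + 1) => Fin ℓ) (a, f) j) then 1 else 0) =
          (if c a then 1 else 0) + ∑ j, if c (f j) then 1 else 0 := by
        intro f
        rw [Fin.sum_univ_succ]
        simp [Fin.consEquiv]
      simp only [this, ← add_assoc]
      rw [ih]
      by_cases h : c a <;> simp [h]
    rw [Finset.sum_congr rfl fun a _ => h1 a, ← Finset.mul_sum, binStep_pow_succ_apply,
      Finset.sum_ite, Finset.sum_const, Finset.sum_const]
    have h2 : ((Finset.univ.filter fun a : Fin ℓ => ¬ c a = true).card : ℝ) =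
        ℓ - onCount Finset.univ c := by
      have := Finset.card_filter_add_card_filter_not (s := (Finset.univ : Finset (Fin ℓ)))
        (fun a => c a = true)
      rw [Finset.card_univ, Fintype.card_fin] at this
      rw [onCount, eq_sub_iff_add_eq, add_comm]
      exact_mod_cast this
    rw [nsmul_eq_mul, nsmul_eq_mul, h2, ← onCount, pow_succ]
    field_simp
    ring

lemma card_image_eq {ℓ κ : ℕ} {A : Finset (Fin ℓ)} (hA : A.card = κ) :
    (Finset.univ.filter fun f : Fin κ → Fin ℓ => Finset.univ.image f = A).card =
      κ.factorial := by
  have e : {f : Fin κ → Fin ℓ // Finset.univ.image f = A} ≃ (Fin κ ↪ A) :=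
    { toFun := fun f => ⟨fun j => ⟨f.1 j, by
          have h := Finset.mem_image_of_mem f.1 (Finset.mem_univ j)
          rwa [f.2] at h⟩, by
        have h : Set.InjOn f.1 (Finset.univ : Finset (Fin κ)) := by
          rw [← Finset.card_image_iff, f.2, hA, Finset.card_univ, Fintype.card_fin]
        intro i j hij
        exact h (by simp) (by simp) (Subtype.ext_iff.1 hij)⟩
      invFun := fun e => ⟨fun j => (e j : Fin ℓ), by
        refine Finset.eq_of_subset_of_card_le ?_ ?_
        · intro i hi
          obtain ⟨j, -, rfl⟩ := Finset.mem_image.1 hi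
          exact (e j).2
        · rw [hA]
          exact ((Finset.card_image_of_injective _
            fun i j hij => e.injective (Subtype.ext hij)).trans (by simp)).ge⟩
      left_inv := fun f => rfl
      right_inv := fun e => rfl }
  rw [← Fintype.card_subtype, Fintype.card_congr e, Fintype.card_embedding_eq, Fintype.card_coe,
    hA, Fintype.card_fin, Nat.descFactorial_self]

lemma onCount_image {ℓ κ : ℕ} {f : Fin κ → Fin ℓ} (hf : Function.Injective f) (c : Fin ℓ → Bool) :
    onCount (Finset.univ.image f) c = ∑ j, if c (f j) then 1 else 0 := by
  rw [onCount, Finset.card_filter, Finset.sum_image fun i _ j _ h => hf h]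

/-- Each `κ`-set is the image of `κ!` tuples. Tuples with repetitions contribute nothing, because
every estimate has exactly `κ` elements. -/
lemma one_sub_errorProb {P σ σw γ : ℝ} (hP : 0 < P) (hσw : 0 < σw) (hγ : 0 < γ) {ℓ n κ : ℕ}
    (hκ : κ ≤ ℓ) (x : Preambles ℓ n) (g : Detector ℓ n κ) :
    (ℓ.descFactorial κ : ℝ) * (1 - errorProb P σ σw γ x g) =
      ∑ f : Fin κ → Fin ℓ, ∑ z : Fin n → Bool with g.estimate z = Finset.univ.image f,
        ∏ t, bern (onProb P σ σw γ (∑ j, if x (f j) t then 1 else 0)) (z t) := by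
  have hch : (ℓ.choose κ : ℝ) ≠ 0 := by exact_mod_cast (Nat.choose_pos hκ).ne'
  have h1 : (ℓ.choose κ : ℝ) * (1 - errorProb P σ σw γ x g) =
      ∑ A ∈ (Finset.univ : Finset (Fin ℓ)).powersetCard κ,
        ∑ z : Fin n → Bool with g.estimate z = A,
          ∏ t, bern (onProb P σ σw γ (onCount A fun i => x i t)) (z t) := by
    rw [errorProb_eq hP hσw hγ, mul_sub, ← mul_assoc, mul_one_div_cancel hch, one_mul, mul_one]
    have : (ℓ.choose κ : ℝ) =
        ∑ A ∈ (Finset.univ : Finset (Fin ℓ)).powersetCard κ, (1 : ℝ) := by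
      simp [Finset.card_powersetCard]
    rw [this, ← Finset.sum_sub_distrib]
    refine Finset.sum_congr rfl fun A _ => ?_
    rw [sub_eq_iff_eq_add, Finset.sum_filter_add_sum_filter_not, sum_prod_bern]
  rw [Nat.descFactorial_eq_factorial_mul_choose, Nat.cast_mul, mul_assoc, h1, Finset.mul_sum]
  have h2 : ∀ A ∈ (Finset.univ : Finset (Fin ℓ)).powersetCard κ,
      (κ.factorial : ℝ) * ∑ z : Fin n → Bool with g.estimate z = A,
          ∏ t, bern (onProb P σ σw γ (onCount A fun i => x i t)) (z t) =
      ∑ f : Fin κ → Fin ℓ with Finset.univ.image f = A,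
        ∑ z : Fin n → Bool with g.estimate z = Finset.univ.image f,
          ∏ t, bern (onProb P σ σw γ (∑ j, if x (f j) t then 1 else 0)) (z t) := by
    intro A hA
    have hcard := (Finset.mem_powersetCard.1 hA).2
    rw [← card_image_eq hcard, ← nsmul_eq_mul, ← Finset.sum_const]
    refine Finset.sum_congr rfl fun f hf => ?_
    have hfA := (Finset.mem_filter.1 hf).2
    have hinj : Function.Injective f := by
      have : Set.InjOn f (Finset.univ : Finset (Fin κ)) := by
        rw [← Finset.card_image_iff, hfA, hcard, Finset.card_univ, Fintype.card_fin]
      intro i j hij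
      exact this (by simp) (by simp) hij
    simp only [← hfA, onCount_image hinj]
  rw [Finset.sum_congr rfl h2]
  simp only [Finset.sum_filter]
  rw [Finset.sum_comm]
  refine Finset.sum_congr rfl fun f _ => ?_
  rw [Finset.sum_ite_eq]
  split_ifs with hf
  · rfl
  · refine (Finset.sum_eq_zero fun z _ => if_neg fun hz => hf ?_).symm
    rw [← hz]
    exact Finset.mem_powersetCard.2 ⟨Finset.subset_univ _, g.card_estimate z⟩

/-- A form of the data processing inequality for the relative entropy. -/
lemma le_relEntropy {Ω : Type*} [Fintype Ω] [DecidableEq Ω] {p r : Ω → ℝ} (hp : ∀ ω, 0 < p ω)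
    (hr : ∀ ω, 0 < r ω) (hp1 : ∑ ω, p ω = 1) (hr1 : ∑ ω, r ω = 1) (S : Finset Ω) {L : ℝ}
    (hS : ∑ ω ∈ S, r ω ≤ Real.exp (-L)) :
    (∑ ω ∈ S, p ω) * L - 1 ≤ ∑ ω, p ω * (Real.log (p ω) - Real.log (r ω)) := by
  -- Tangents at ratio `exp L` on `S` and at ratio `1` off `S`; the total loss is at most `r(S) *
  -- exp L ≤ 1`.
  have h1 : ∑ ω ∈ S, (p ω * L + (p ω - r ω * Real.exp L)) ≤
      ∑ ω ∈ S, p ω * (Real.log (p ω) - Real.log (r ω)) := by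
    refine Finset.sum_le_sum fun ω _ => ?_
    have := mul_log_sub_log_ge (hp ω) (hr ω) (Real.exp_pos L) one_pos
    simpa using this
  have h2 : ∑ ω ∈ Sᶜ, (p ω - r ω) ≤ ∑ ω ∈ Sᶜ, p ω * (Real.log (p ω) - Real.log (r ω)) := by
    refine Finset.sum_le_sum fun ω _ => ?_
    have := mul_log_sub_log_ge (hp ω) (hr ω) one_pos one_pos
    simpa using this
  rw [← Finset.sum_add_sum_compl S fun ω => p ω * (Real.log (p ω) - Real.log (r ω))]
  rw [← Finset.sum_add_sum_compl S] at hp1 hr1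
  simp only [Finset.sum_add_distrib, Finset.sum_sub_distrib, ← Finset.sum_mul] at h1 h2
  have h3 : (∑ ω ∈ S, r ω) * Real.exp L ≤ 1 := by
    calc _ ≤ Real.exp (-L) * Real.exp L := mul_le_mul_of_nonneg_right hS (Real.exp_pos L).le
      _ = 1 := by rw [← Real.exp_add]; simp
  have h4 : 0 ≤ ∑ ω ∈ S, r ω := Finset.sum_nonneg fun ω _ => (hr ω).le
  linarith

lemma sum_bern_mul_log {a m : ℝ} : ∑ b, bern a b * (Real.log (bern a b) - Real.log (bern m b)) =
    -Real.binEntropy a - a * Real.log m - (1 - a) * Real.log (1 - m) := by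
  simp [bern, Real.binEntropy, Real.log_inv]
  ring

/-- Relative entropy is additive over product laws, so the information bound can be taken slot by
slot. -/
lemma relEntropy_prod_bern {n : ℕ} {a m : Fin n → ℝ} (ha : ∀ t, a t ∈ Set.Ioo (0 : ℝ) 1)
    (hm : ∀ t, m t ∈ Set.Ioo (0 : ℝ) 1) :
    ∑ z : Fin n → Bool, (∏ t, bern (a t) (z t)) *
      (Real.log (∏ t, bern (a t) (z t)) - Real.log (∏ t, bern (m t) (z t))) =
    ∑ t, (-Real.binEntropy (a t) - a t * Real.log (m t) - (1 - a t) * Real.log (1 - m t)) := by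
  have h : ∀ z : Fin n → Bool, (∏ t, bern (a t) (z t)) *
      (Real.log (∏ t, bern (a t) (z t)) - Real.log (∏ t, bern (m t) (z t))) =
      ∑ t, (∏ s, bern (a s) (z s)) *
        (Real.log (bern (a t) (z t)) - Real.log (bern (m t) (z t))) := by
    intro z
    rw [Real.log_prod fun t _ => (bern_pos (ha t) _).ne',
      Real.log_prod fun t _ => (bern_pos (hm t) _).ne', ← Finset.sum_sub_distrib, Finset.mul_sum]
  rw [Finset.sum_congr rfl fun z _ => h z, Finset.sum_comm]
  refine Finset.sum_congr rfl fun t _ => ?_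
  rw [← sum_bern_mul_log]
  exact sum_pi_prod_mul_coord (fun s => sum_bern (a s)) t
    fun b => Real.log (bern (a t) b) - Real.log (bern (m t) b)

/-- A Fano-type bound for messages that are uniform on `Fin κ → Fin ℓ`. -/
lemma correct_prob_le {P σ σw γ : ℝ} (hP : 0 < P) (hσ : 0 < σ) (hσw : 0 < σw) (hγ : 0 < γ)
    {ℓ n κ : ℕ} (hκ : 1 ≤ κ) (hκℓ : κ ≤ ℓ) (x : Preambles ℓ n) (g : Detector ℓ n κ) :
    (ℓ.descFactorial κ / (ℓ : ℝ) ^ κ * (1 - errorProb P σ σw γ x g)) *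
        (κ * Real.log ℓ - Real.log κ.factorial) - 1 ≤
      n * (maxRate P σ σw κ * Real.log 2) := by
  have hℓ : 0 < ℓ := by omega
  have hℓ' : (0 : ℝ) < ℓ := by exact_mod_cast hℓ
  set N : ℝ := (ℓ : ℝ) ^ κ with hN
  have hN0 : 0 < N := by positivity
  set p := onProb P σ σw γ with hp
  have hpm : ∀ v, p v ∈ Set.Ioo (0 : ℝ) 1 := onProb_mem_Ioo hP hσw hγ
  set V : (Fin κ → Fin ℓ) → Fin n → ℕ := fun f t => ∑ j, if x (f j) t then 1 else 0 with hV
  -- The fraction of On users acts as a sampling probability for slot `t`, so deterministic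
  -- preambles are covered by the same maximum.
  set Q : Fin n → ℝ := fun t => onCount Finset.univ (fun i => x i t) / ℓ with hQ
  have hQm : ∀ t, Q t ∈ Set.Icc (0 : ℝ) 1 := by
    intro t
    refine ⟨by positivity, (div_le_one hℓ').2 ?_⟩
    have : onCount Finset.univ (fun i => x i t) ≤ ℓ := by
      have := Finset.card_filter_le (Finset.univ : Finset (Fin ℓ)) fun i => x i t
      simpa [onCount] using this
    exact_mod_cast this
  set m : Fin n → ℝ := fun t => (binStep (Q t) ^ κ) p 0 with hm
  have hmm : ∀ t, m t ∈ Set.Ioo (0 : ℝ) 1 := fun t => binStep_pow_mem_Ioo (hQm t) κ hpm 0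
  have havg : ∀ (φ : ℕ → ℝ) t, ∑ f, φ (V f t) = N * (binStep (Q t) ^ κ) φ 0 := by
    intro φ t
    have := sum_with_replacement hℓ (fun i => x i t) φ κ 0
    simpa only [zero_add] using this
  have hcardβ : ∑ _f : Fin κ → Fin ℓ, (1 : ℝ) = N := by simp [hN]
  set pr : (Fin κ → Fin ℓ) × (Fin n → Bool) → ℝ :=
    fun ω => N⁻¹ * ∏ t, bern (p (V ω.1 t)) (ω.2 t) with hpr
  set rr : (Fin κ → Fin ℓ) × (Fin n → Bool) → ℝ :=
    fun ω => N⁻¹ * ∏ t, bern (m t) (ω.2 t) with hrr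
  have hWpos : ∀ f (z : Fin n → Bool), 0 < ∏ t, bern (p (V f t)) (z t) := fun f z =>
    Finset.prod_pos fun t _ => bern_pos (hpm _) _
  have hQpos : ∀ z : Fin n → Bool, 0 < ∏ t, bern (m t) (z t) := fun z =>
    Finset.prod_pos fun t _ => bern_pos (hmm _) _
  have hprpos : ∀ ω, 0 < pr ω := fun ω => mul_pos (inv_pos.2 hN0) (hWpos _ _)
  have hrrpos : ∀ ω, 0 < rr ω := fun ω => mul_pos (inv_pos.2 hN0) (hQpos _)
  have hpr1 : ∑ ω, pr ω = 1 := by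
    simp only [hpr, Fintype.sum_prod_type, ← Finset.mul_sum, sum_prod_bern, hcardβ]
    exact inv_mul_cancel₀ hN0.ne'
  have hrr1 : ∑ ω, rr ω = 1 := by
    simp only [hrr, Fintype.sum_prod_type, ← Finset.mul_sum, sum_prod_bern, hcardβ]
    exact inv_mul_cancel₀ hN0.ne'
  set S : Finset ((Fin κ → Fin ℓ) × (Fin n → Bool)) :=
    Finset.univ.filter fun ω => g.estimate ω.2 = Finset.univ.image ω.1 with hS
  have hfac : (0 : ℝ) < κ.factorial := by exact_mod_cast Nat.factorial_pos κ
  -- Under `rr` the output is independent of the tuple, and exactly `κ!` tuples have the estimate as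
  -- image.
  have hSr : ∑ ω ∈ S, rr ω ≤ Real.exp (-(κ * Real.log ℓ - Real.log κ.factorial)) := by
    have e : Real.exp (-(κ * Real.log ℓ - Real.log κ.factorial)) = N⁻¹ * κ.factorial := by
      rw [neg_sub, Real.exp_sub, Real.exp_log hfac, ← Real.log_pow, Real.exp_log (by positivity),
        div_eq_inv_mul]
    rw [e, hS, Finset.sum_filter, Fintype.sum_prod_type, Finset.sum_comm]
    have : ∀ z : Fin n → Bool, (∑ f : Fin κ → Fin ℓ,
        if g.estimate z = Finset.univ.image f then rr (f, z) else 0) =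
        (N⁻¹ * κ.factorial) * ∏ t, bern (m t) (z t) := by
      intro z
      simp only [hrr]
      rw [← Finset.sum_filter, Finset.sum_const, nsmul_eq_mul, ← card_image_eq (g.card_estimate z)]
      simp only [eq_comm (a := g.estimate z)]
      ring
    rw [Finset.sum_congr rfl fun z _ => this z, ← Finset.mul_sum, sum_prod_bern, mul_one]
  have hSp : ∑ ω ∈ S, pr ω = ℓ.descFactorial κ / N * (1 - errorProb P σ σw γ x g) := by
    rw [div_mul_eq_mul_div, one_sub_errorProb hP hσw hγ hκℓ, hS, Finset.sum_filter,
      Fintype.sum_prod_type, div_eq_inv_mul, Finset.mul_sum]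
    refine Finset.sum_congr rfl fun f _ => ?_
    rw [← Finset.sum_filter, Finset.mul_sum]
  have hmain := le_relEntropy hprpos hrrpos hpr1 hrr1 S hSr
  rw [hSp] at hmain
  refine hmain.trans ?_
  have hinfo : ∑ ω, pr ω * (Real.log (pr ω) - Real.log (rr ω)) =
      ∑ t, (condEntropy p (Q t) κ κ - condEntropy p (Q t) κ 0) := by
    have h1 : ∀ f z, pr (f, z) * (Real.log (pr (f, z)) - Real.log (rr (f, z))) =
        N⁻¹ * ((∏ t, bern (p (V f t)) (z t)) * (Real.log (∏ t, bern (p (V f t)) (z t)) -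
          Real.log (∏ t, bern (m t) (z t)))) := by
      intro f z
      simp only [hpr, hrr]
      rw [Real.log_mul (inv_pos.2 hN0).ne' (hWpos f z).ne',
        Real.log_mul (inv_pos.2 hN0).ne' (hQpos z).ne']
      ring
    rw [Fintype.sum_prod_type]
    simp only [h1, ← Finset.mul_sum]
    rw [Finset.sum_congr rfl fun f _ => relEntropy_prod_bern (fun t => hpm (V f t)) hmm,
      Finset.sum_comm, Finset.mul_sum]
    refine Finset.sum_congr rfl fun t _ => ?_
    -- Apart from the entropy, the term is affine in `p (V f t)`; averaging replaces it by `m t`,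
    -- and the cross entropy becomes the entropy of `m t`.
    have h2 : ∀ f : Fin κ → Fin ℓ, -Real.binEntropy (p (V f t)) - p (V f t) * Real.log (m t) -
        (1 - p (V f t)) * Real.log (1 - m t) =
        -Real.binEntropy (p (V f t)) - p (V f t) * (Real.log (m t) - Real.log (1 - m t)) -
        1 * Real.log (1 - m t) := fun f => by ring
    rw [Finset.sum_congr rfl fun f _ => h2 f, Finset.sum_sub_distrib, Finset.sum_sub_distrib,
      ← Finset.sum_mul, ← Finset.sum_mul, hcardβ, Finset.sum_neg_distrib,
      havg (fun v => Real.binEntropy (p v)) t, havg p t]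
    simp only [condEntropy, Nat.sub_self, Nat.sub_zero, pow_zero, Module.End.one_apply]
    change _ = Real.binEntropy (m t) - _
    rw [Real.binEntropy, Real.log_inv, Real.log_inv]
    change N⁻¹ * (-(N * _) - N * m t * _ - _) = _
    field_simp
    ring
  rw [hinfo]
  have hb : ∀ t, condEntropy p (Q t) κ κ - condEntropy p (Q t) κ 0 ≤
      maxRate P σ σw κ * Real.log 2 := by
    intro t
    have := (isGreatest_maxRate hP hσ hσw hκ).2 ⟨γ, Q t, hγ, hQm t, rfl⟩
    rwa [rate_eq_condEntropy, div_le_iff₀ (Real.log_pos one_lt_two)] at this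
  refine (Finset.sum_le_sum fun t _ => hb t).trans ?_
  simp

lemma tendsto_descFactorial_div_pow (κ : ℕ) :
    Tendsto (fun ℓ : ℕ => (ℓ.descFactorial κ : ℝ) / (ℓ : ℝ) ^ κ) atTop (𝓝 1) := by
  induction κ with
  | zero => simp
  | succ κ ih =>
    have h1 : Tendsto (fun ℓ : ℕ => ((ℓ : ℝ) - κ) / ℓ) atTop (𝓝 1) := by
      have : Tendsto (fun ℓ : ℕ => 1 - (κ : ℝ) / ℓ) atTop (𝓝 (1 - 0)) :=
        tendsto_const_nhds.sub (tendsto_const_div_atTop_nhds_zero_nat (κ : ℝ))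
      rw [sub_zero] at this
      refine this.congr' ?_
      filter_upwards [eventually_gt_atTop 0] with ℓ hℓ
      have : (ℓ : ℝ) ≠ 0 := by exact_mod_cast hℓ.ne'
      field_simp
    have h2 := h1.mul ih
    rw [one_mul] at h2
    refine h2.congr' ?_
    filter_upwards [eventually_gt_atTop κ] with ℓ hℓ
    rw [Nat.descFactorial_succ, Nat.cast_mul, Nat.cast_sub hℓ.le, pow_succ]
    have : (ℓ : ℝ) ≠ 0 := by exact_mod_cast (by omega : ℓ ≠ 0)
    field_simp

lemma eventually_errorProb_ge {P σ σw : ℝ} (hP : 0 < P) (hσ : 0 < σ) (hσw : 0 < σw) {κ : ℕ}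
    (hκ : 1 ≤ κ) {ε : ℝ} (hε : 0 < ε) :
    ∀ᶠ ℓ : ℕ in atTop, ∀ (γ : ℝ) (n : ℕ) (x : Preambles ℓ n) (g : Detector ℓ n κ), 0 < γ →
      (n : ℝ) ≤ (1 - ε) * (κ * Real.logb 2 ℓ / maxRate P σ σw κ) →
      ε / 2 ≤ errorProb P σ σw γ x g := by
  have hC := maxRate_pos hP hσ hσw hκ
  have hκ0 : (0 : ℝ) < κ := by exact_mod_cast hκ
  have hlog : Tendsto (fun ℓ : ℕ => Real.log ℓ) atTop atTop :=
    Real.tendsto_log_atTop.comp tendsto_natCast_atTop_atTop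
  have hlim : Tendsto (fun ℓ : ℕ => (1 - ε / 2) * ((ℓ.descFactorial κ : ℝ) / (ℓ : ℝ) ^ κ *
      (κ - Real.log κ.factorial / Real.log ℓ)) - 1 / Real.log ℓ) atTop
      (𝓝 ((1 - ε / 2) * (1 * (κ - 0)) - 0)) := by
    refine Tendsto.sub (Tendsto.const_mul _ ((tendsto_descFactorial_div_pow κ).mul
      (tendsto_const_nhds.sub ?_))) ?_
    · exact hlog.const_div_atTop _
    · exact hlog.const_div_atTop _
  -- The error level `ε / 2` leaves a gap to `ε` that absorbs the vanishing corrections from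
  -- repetitions, `log κ!` and the additive `1`.
  have hlt : (1 - ε) * κ < (1 - ε / 2) * (1 * (κ - 0)) - 0 := by nlinarith
  filter_upwards [hlim.eventually (lt_mem_nhds hlt), eventually_ge_atTop κ,
    hlog.eventually_gt_atTop 0, hlog.eventually_gt_atTop (Real.log κ.factorial / κ)]
    with ℓ h1 h2 h3 h4 γ n x g hγ hn
  by_contra hcon
  push Not at hcon
  have hmain := correct_prob_le hP hσ hσw hγ hκ h2 x g
  have hn' : n * (maxRate P σ σw κ * Real.log 2) ≤ (1 - ε) * (κ * Real.log ℓ) := by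
    have := mul_le_mul_of_nonneg_right hn
      (mul_pos hC (Real.log_pos one_lt_two)).le
    refine this.trans (le_of_eq ?_)
    rw [Real.logb]
    have := (Real.log_pos one_lt_two).ne'
    field_simp
  have h5 : 0 < κ * Real.log ℓ - Real.log κ.factorial := by
    rw [div_lt_iff₀ hκ0] at h4
    linarith
  set r := (ℓ.descFactorial κ : ℝ) / (ℓ : ℝ) ^ κ with hr
  have hr0 : 0 ≤ r := by positivity
  have h6 : r * (1 - ε / 2) * (κ * Real.log ℓ - Real.log κ.factorial) ≤
      r * (1 - errorProb P σ σw γ x g) * (κ * Real.log ℓ - Real.log κ.factorial) := by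
    refine mul_le_mul_of_nonneg_right (mul_le_mul_of_nonneg_left ?_ hr0) h5.le
    linarith
  have h7 := mul_lt_mul_of_pos_right h1 h3
  have h8 : ((1 - ε / 2) * (r * (κ - Real.log κ.factorial / Real.log ℓ)) - 1 / Real.log ℓ) *
      Real.log ℓ = r * (1 - ε / 2) * (κ * Real.log ℓ - Real.log κ.factorial) - 1 := by
    field_simp
  rw [h8] at h7
  linarith

/-! ### Achievability: one random slot and the information density. -/

/-- The probability of the column `c` of i.i.d. `Bern(q)` symbols. -/
def colProb {ℓ : ℕ} (q : ℝ) (c : Fin ℓ → Bool) : ℝ := ∏ i, bern q (c i)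

lemma bern_nonneg {q : ℝ} (hq : q ∈ Set.Icc (0 : ℝ) 1) (b : Bool) : 0 ≤ bern q b := by
  cases b <;> simp [bern, hq.1, hq.2]

lemma sum_colProb (ℓ : ℕ) (q : ℝ) : ∑ c : Fin ℓ → Bool, colProb q c = 1 := sum_prod_bern _

lemma sum_colProb_resample {ℓ : ℕ} (q : ℝ) (i : Fin ℓ) (F : (Fin ℓ → Bool) → ℝ) :
    ∑ c, colProb q c * F c = ∑ c, colProb q c *
      ((1 - q) * F (Function.update c i false) + q * F (Function.update c i true)) := by
  let e : (Fin ℓ → Bool) → (Fin ℓ → Bool) := fun c => Function.update c i (!c i)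
  have he : Function.Involutive e := by
    intro c
    simp [e]
  have hsum : ∀ f : (Fin ℓ → Bool) → ℝ, ∑ c, f c = ∑ c, f (e c) := fun f =>
    (Equiv.sum_comp he.toPerm f).symm
  have hcol : ∀ c : Fin ℓ → Bool, colProb q c =
      bern q (c i) * ∏ j ∈ Finset.univ.erase i, bern q (c j) := fun c =>
    (Finset.mul_prod_erase _ _ (Finset.mem_univ i)).symm
  have hrest : ∀ c : Fin ℓ → Bool, ∏ j ∈ Finset.univ.erase i, bern q (e c j) =
      ∏ j ∈ Finset.univ.erase i, bern q (c j) := by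
    intro c
    refine Finset.prod_congr rfl fun j hj => ?_
    simp only [e]
    rw [Function.update_of_ne (Finset.ne_of_mem_erase hj)]
  rw [← sub_eq_zero, ← Finset.sum_sub_distrib]
  set f : (Fin ℓ → Bool) → ℝ := fun c => colProb q c * F c - colProb q c *
      ((1 - q) * F (Function.update c i false) + q * F (Function.update c i true)) with hf
  -- The difference of the two sides cancels within each pair of columns that differ only at user
  -- `i`.
  have h0 : ∀ c, f c + f (e c) = 0 := by
    intro c
    simp only [hf, hcol, hrest]
    have h1 : ∀ b, Function.update (e c) i b = Function.update c i b := by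
      intro b; simp [e]
    have h2 : e c i = !c i := by simp [e]
    rw [h1, h1, h2]
    cases hb : c i
    · have h3 : Function.update c i false = c := by rw [← hb, Function.update_eq_self]
      have h4 : e c = Function.update c i true := by simp [e, hb]
      rw [h3, h4]
      simp [bern]
      ring
    · have h3 : Function.update c i true = c := by rw [← hb, Function.update_eq_self]
      have h4 : e c = Function.update c i false := by simp [e, hb]
      rw [h3, h4]
      simp [bern]
      ring
  have h1 : ∑ c, f c + ∑ c, f c = 0 := by
    nth_rewrite 2 [hsum f]
    rw [← Finset.sum_add_distrib]
    exact Finset.sum_eq_zero fun c _ => h0 c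
  linarith

lemma onCount_insert {ℓ : ℕ} {D : Finset (Fin ℓ)} {i : Fin ℓ} (hi : i ∉ D) (c : Fin ℓ → Bool) :
    onCount (insert i D) c = onCount D c + if c i then 1 else 0 := by
  rw [onCount, onCount, Finset.card_filter, Finset.card_filter, Finset.sum_insert hi, add_comm]

lemma onCount_update {ℓ : ℕ} {D : Finset (Fin ℓ)} {i : Fin ℓ} (hi : i ∉ D) (c : Fin ℓ → Bool)
    (b : Bool) : onCount D (Function.update c i b) = onCount D c := by
  rw [onCount, onCount]
  congr 1
  refine Finset.filter_congr fun j hj => ?_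
  rw [Function.update_of_ne (ne_of_mem_of_not_mem hj hi)]

lemma onCount_union {ℓ : ℕ} {D E : Finset (Fin ℓ)} (h : Disjoint D E) (c : Fin ℓ → Bool) :
    onCount (D ∪ E) c = onCount D c + onCount E c := by
  rw [onCount, Finset.filter_union, Finset.card_union_of_disjoint
    (Finset.disjoint_filter_filter h), onCount, onCount]

/-- The number of users of `D` that are on is binomial and independent of the other users. -/
lemma sum_colProb_onCount {ℓ : ℕ} (q : ℝ) (D : Finset (Fin ℓ))
    (G : (Fin ℓ → Bool) → ℕ → ℝ) (hG : ∀ c, ∀ i ∈ D, ∀ b, G (Function.update c i b) = G c) :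
    ∑ c, colProb q c * G c (onCount D c) =
      ∑ c, colProb q c * (binStep q ^ D.card) (G c) 0 := by
  induction D using Finset.induction_on generalizing G with
  | empty => simp [onCount]
  | insert i D hi ih =>
    rw [sum_colProb_resample q i, Finset.card_insert_of_notMem hi, pow_succ]
    have h := ih (fun c => binStep q (G c)) fun c j hj b => by
      rw [hG c j (Finset.mem_insert_of_mem hj) b]
    simp only [Module.End.mul_apply]
    rw [← h]
    refine Finset.sum_congr rfl fun c _ => ?_
    rw [onCount_insert hi, onCount_insert hi, onCount_update hi, onCount_update hi,
      hG c i (Finset.mem_insert_self _ _), hG c i (Finset.mem_insert_self _ _), binStep_apply]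
    simp

lemma binStep_pow_shift (q : ℝ) (n : ℕ) (f : ℕ → ℝ) (v : ℕ) :
    (binStep q ^ n) (fun j => f (v + j)) 0 = (binStep q ^ n) f v := by
  simp [binStep_pow_apply]

lemma binStep_pow_affine (q : ℝ) (n : ℕ) (f : ℕ → ℝ) (a b : ℝ) (v : ℕ) :
    (binStep q ^ n) (fun u => a * f u + b) v = a * (binStep q ^ n) f v + b := by
  have : (fun u => a * f u + b) = a • f + fun _ => b := by ext u; simp
  rw [this, map_add, map_smul, Pi.add_apply, binStep_pow_const]
  simp

lemma bern_eq (x : ℝ) (b : Bool) :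
    bern x b = (if b then 1 else -1) * x + (if b then 0 else 1) := by
  cases b <;> simp [bern]; ring

lemma binStep_pow_bern (q : ℝ) (n : ℕ) (f : ℕ → ℝ) (b : Bool) (v : ℕ) :
    (binStep q ^ n) (fun u => bern (f u) b) v = bern ((binStep q ^ n) f v) b := by
  simp only [bern_eq, binStep_pow_affine]

lemma binStep_pow_hasDerivAt (q : ℝ) (n : ℕ) {f : ℝ → ℕ → ℝ} {f' : ℕ → ℝ} {x : ℝ}
    (hf : ∀ v, HasDerivAt (fun s => f s v) (f' v) x) (v : ℕ) :
    HasDerivAt (fun s => (binStep q ^ n) (f s) v) ((binStep q ^ n) f' v) x := by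
  induction n generalizing v with
  | zero => simpa using hf v
  | succ n ih =>
    simp only [binStep_pow_succ_apply]
    exact ((ih v).const_mul _).add ((ih (v + 1)).const_mul _)

/-- The likelihood ratio between "`A` is active" and "`A \ D` is active, together with `|D|`
unknown users". -/
def likRatio {ℓ : ℕ} (p : ℕ → ℝ) (q : ℝ) (A D : Finset (Fin ℓ)) (c : Fin ℓ → Bool) (b : Bool) :
    ℝ :=
  bern (p (onCount A c)) b / bern ((binStep q ^ D.card) p (onCount (A \ D) c)) b

lemma likRatio_pos {ℓ : ℕ} {p : ℕ → ℝ} (hp : ∀ v, p v ∈ Set.Ioo (0 : ℝ) 1) {q : ℝ}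
    (hq : q ∈ Set.Icc (0 : ℝ) 1) (A D : Finset (Fin ℓ)) (c : Fin ℓ → Bool) (b : Bool) :
    0 < likRatio p q A D c b :=
  div_pos (bern_pos (hp _) b) (bern_pos (binStep_pow_mem_Ioo hq _ hp _) b)

/-- The exponential moment `E[exp(-s (ı - μ))]` of the information density `ı` of `i` out of `κ`
users, given the others. -/
def expMoment (p : ℕ → ℝ) (q : ℝ) (κ i : ℕ) (μ s : ℝ) : ℝ :=
  (binStep q ^ (κ - i)) (fun v => (binStep q ^ i) (fun u => ∑ b, bern (p u) b *
    Real.exp (-s * (Real.log (bern (p u) b) - Real.log (bern ((binStep q ^ i) p v) b) - μ))) v) 0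

/-- The On counts of `D` and `A \ D` are independent binomials. Averaging over `D`, then over `A \
D`, leaves a quantity depending on the cardinalities only. -/
lemma sum_colProb_expMoment {ℓ : ℕ} {p : ℕ → ℝ} (hp : ∀ v, p v ∈ Set.Ioo (0 : ℝ) 1) {q : ℝ}
    (hq : q ∈ Set.Icc (0 : ℝ) 1) {A D : Finset (Fin ℓ)} (hD : D ⊆ A) (μ s : ℝ) :
    ∑ c, colProb q c * ∑ b, bern (p (onCount A c)) b *
      Real.exp (-s * (Real.log (likRatio p q A D c b) - μ)) =
    expMoment p q A.card D.card μ s := by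
  have hcount : ∀ c : Fin ℓ → Bool, onCount A c = onCount (A \ D) c + onCount D c := fun c => by
    rw [← onCount_union Finset.sdiff_disjoint, Finset.sdiff_union_of_subset hD]
  set φ : ℕ → ℕ → ℝ := fun v u => ∑ b, bern (p u) b * Real.exp (-s * (Real.log (bern (p u) b) -
    Real.log (bern ((binStep q ^ D.card) p v) b) - μ)) with hφ
  have h1 : ∀ c : Fin ℓ → Bool, ∑ b, bern (p (onCount A c)) b *
      Real.exp (-s * (Real.log (likRatio p q A D c b) - μ)) =
      φ (onCount (A \ D) c) (onCount (A \ D) c + onCount D c) := by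
    intro c
    simp only [hφ, ← hcount]
    refine Finset.sum_congr rfl fun b _ => ?_
    rw [likRatio, Real.log_div (bern_pos (hp _) b).ne'
      (bern_pos (binStep_pow_mem_Ioo hq _ hp _) b).ne']
  simp only [h1]
  rw [sum_colProb_onCount q D
    (fun c n => φ (onCount (A \ D) c) (onCount (A \ D) c + n)) fun c i hi b => by
      rw [onCount_update (fun h => (Finset.mem_sdiff.1 h).2 hi)]]
  simp only [binStep_pow_shift]
  rw [sum_colProb_onCount q (A \ D) (fun _ v => (binStep q ^ D.card) (φ v) v)
    fun c i hi b => rfl, ← Finset.sum_mul, sum_colProb, one_mul, Finset.card_sdiff_of_subset hD]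
  rfl

/-- Given the symbols of `A'`, the users of `A \ A'` are fresh and as many as those of `A' \ A`.
Averaging over them turns the true output law into the denominator of the ratio, which cancels. This
is the input to Markov's inequality for a wrong set `A'`. -/
lemma sum_colProb_likRatio {ℓ : ℕ} {p : ℕ → ℝ} (hp : ∀ v, p v ∈ Set.Ioo (0 : ℝ) 1) {q : ℝ}
    (hq : q ∈ Set.Icc (0 : ℝ) 1) {A A' : Finset (Fin ℓ)} (hA : A.card = A'.card) :
    ∑ c, colProb q c * ∑ b, bern (p (onCount A c)) b * likRatio p q A' (A' \ A) c b = 1 := by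
  have hcount : ∀ c : Fin ℓ → Bool, onCount A c = onCount (A' \ (A' \ A)) c + onCount (A \ A') c :=
    fun c => by
      have h1 : A' \ (A' \ A) = A ∩ A' := by
        rw [sdiff_sdiff_right_self, Finset.inf_eq_inter, Finset.inter_comm]
      have h2 : Disjoint (A ∩ A') (A \ A') := (Finset.disjoint_sdiff_inter A A').symm
      rw [h1, ← onCount_union h2, Finset.union_comm, Finset.sdiff_union_inter]
  have hcard : (A \ A').card = (A' \ A).card := Finset.card_sdiff_comm hA
  simp only [hcount]
  have hinv : ∀ c : Fin ℓ → Bool, ∀ i ∈ A \ A', ∀ b,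
      onCount (A' \ (A' \ A)) (Function.update c i b) = onCount (A' \ (A' \ A)) c := by
    intro c i hi b
    refine onCount_update (fun h => ?_) c b
    exact (Finset.mem_sdiff.1 hi).2 (Finset.mem_sdiff.1 h).1
  rw [sum_colProb_onCount q (A \ A') (fun c n => ∑ b, bern (p (onCount (A' \ (A' \ A)) c + n)) b *
    likRatio p q A' (A' \ A) c b) fun c i hi b => by
      rw [hinv c i hi b]
      have h2 : onCount A' (Function.update c i b) = onCount A' c :=
        onCount_update (Finset.mem_sdiff.1 hi).2 c b
      simp only [likRatio, h2, hinv c i hi b], ← sum_colProb ℓ q]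
  refine Finset.sum_congr rfl fun c _ => ?_
  have h3 : (fun n => ∑ b, bern (p (onCount (A' \ (A' \ A)) c + n)) b *
      likRatio p q A' (A' \ A) c b) = ∑ b, likRatio p q A' (A' \ A) c b •
        fun n => bern (p (onCount (A' \ (A' \ A)) c + n)) b := by
    ext n
    rw [Finset.sum_apply]
    exact Finset.sum_congr rfl fun b _ => mul_comm _ _
  rw [h3, map_sum, Finset.sum_apply]
  simp only [map_smul, Pi.smul_apply, smul_eq_mul, hcard]
  have h4 : ∀ b, likRatio p q A' (A' \ A) c b * (binStep q ^ (A' \ A).card)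
      (fun n => bern (p (onCount (A' \ (A' \ A)) c + n)) b) 0 = bern (p (onCount A' c)) b := by
    intro b
    rw [binStep_pow_shift q _ (fun n => bern (p n) b), binStep_pow_bern, likRatio,
      div_mul_cancel₀ _ (bern_pos (binStep_pow_mem_Ioo hq _ hp _) b).ne']
  rw [Finset.sum_congr rfl fun b _ => h4 b, sum_bern, mul_one]

lemma expMoment_nonneg {p : ℕ → ℝ} (hp : ∀ v, p v ∈ Set.Ioo (0 : ℝ) 1) {q : ℝ}
    (hq : q ∈ Set.Icc (0 : ℝ) 1) (κ i : ℕ) (μ s : ℝ) : 0 ≤ expMoment p q κ i μ s := by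
  have h0 : ∀ n v, (binStep q ^ n) (fun _ => 0) v = 0 := fun n v => binStep_pow_const q n 0 v
  rw [expMoment, ← h0 (κ - i) 0]
  refine binStep_pow_mono hq _ (fun v => ?_) 0
  rw [← h0 i v]
  refine binStep_pow_mono hq _ (fun u => ?_) v
  exact Finset.sum_nonneg fun b _ => mul_nonneg (bern_pos (hp u) b).le (Real.exp_pos _).le

/-- Chernoff: the exponential moment equals `1` at `s = 0`, and its slope there is `μ` minus the
mean information density, hence negative. -/
lemma exists_expMoment_lt_one {p : ℕ → ℝ} {q : ℝ} {κ i : ℕ} (hi : i ≤ κ) {μ : ℝ}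
    (hμ : μ < condEntropy p q κ i - condEntropy p q κ 0) :
    ∃ s, 0 < s ∧ expMoment p q κ i μ s < 1 := by
  have h0 : expMoment p q κ i μ 0 = 1 := by
    simp only [expMoment, neg_zero, zero_mul, Real.exp_zero, mul_one, sum_bern, binStep_pow_const]
  have hd : HasDerivAt (expMoment p q κ i μ)
      (-(condEntropy p q κ i - condEntropy p q κ 0 - μ)) 0 := by
    have h1 : ∀ v u, HasDerivAt (fun s => ∑ b, bern (p u) b * Real.exp (-s *
        (Real.log (bern (p u) b) - Real.log (bern ((binStep q ^ i) p v) b) - μ)))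
        (∑ b, bern (p u) b *
          -(Real.log (bern (p u) b) - Real.log (bern ((binStep q ^ i) p v) b) - μ)) 0 := by
      intro v u
      refine HasDerivAt.fun_sum fun b _ => ?_
      have h := ((((hasDerivAt_id (0 : ℝ)).neg).mul_const
        (Real.log (bern (p u) b) - Real.log (bern ((binStep q ^ i) p v) b) - μ)).exp).const_mul
        (bern (p u) b)
      simpa using h
    have h2 := binStep_pow_hasDerivAt q (κ - i)
      (fun v => binStep_pow_hasDerivAt q i (fun u => h1 v u) v) 0
    refine h2.congr_deriv ?_
    have h3 : ∀ v, (fun u => ∑ b, bern (p u) b *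
        -(Real.log (bern (p u) b) - Real.log (bern ((binStep q ^ i) p v) b) - μ)) =
        (fun u => Real.binEntropy (p u)) + fun u =>
          (Real.log ((binStep q ^ i) p v) - Real.log (1 - (binStep q ^ i) p v)) * p u +
            (Real.log (1 - (binStep q ^ i) p v) + μ) := by
      intro v
      ext u
      have h4 := sum_bern_mul_log (a := p u) (m := (binStep q ^ i) p v)
      have h5 : ∑ b, bern (p u) b *
          -(Real.log (bern (p u) b) - Real.log (bern ((binStep q ^ i) p v) b) - μ) =
          -(∑ b, bern (p u) b *
            (Real.log (bern (p u) b) - Real.log (bern ((binStep q ^ i) p v) b))) +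
          (∑ b, bern (p u) b) * μ := by
        rw [Finset.sum_mul, ← Finset.sum_neg_distrib, ← Finset.sum_add_distrib]
        exact Finset.sum_congr rfl fun b _ => by ring
      rw [h5, h4, sum_bern, Pi.add_apply]
      ring
    -- Averaging over the `i` unknown users turns the cross entropy into the entropy of the averaged
    -- output; the outer average then yields `condEntropy`.
    have h6 : (fun v => (binStep q ^ i) (fun u => ∑ b, bern (p u) b *
        -(Real.log (bern (p u) b) - Real.log (bern ((binStep q ^ i) p v) b) - μ)) v) =
        (binStep q ^ i) (fun u => Real.binEntropy (p u)) +
        fun v => (-1) * Real.binEntropy ((binStep q ^ i) p v) + μ := by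
      ext v
      rw [h3, map_add, Pi.add_apply, binStep_pow_affine, Pi.add_apply]
      rw [Real.binEntropy, Real.log_inv, Real.log_inv]
      ring
    rw [h6, map_add, Pi.add_apply, binStep_pow_affine, ← Module.End.mul_apply, ← pow_add,
      Nat.sub_add_cancel hi]
    simp only [condEntropy, Nat.sub_zero, pow_zero, Module.End.one_apply]
    ring
  have hlt : ∀ᶠ s in 𝓝[>] (0 : ℝ), expMoment p q κ i μ s < expMoment p q κ i μ 0 := by
    filter_upwards [hd.tendsto_slope_zero_right.eventually
      (gt_mem_nhds (show -(condEntropy p q κ i - condEntropy p q κ 0 - μ) < 0 by linarith)),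
      self_mem_nhdsWithin] with s hs hs0
    rw [zero_add, smul_eq_mul] at hs
    have hs1 : 0 < s := hs0
    have := neg_of_mul_neg_right hs (inv_pos.2 hs1).le
    linarith
  obtain ⟨s, hs, hs0⟩ := (hlt.and self_mem_nhdsWithin).exists
  exact ⟨s, hs0, h0 ▸ hs⟩

/-! ### Random preambles and the threshold detector. -/

lemma preambleProb_nonneg {ℓ n : ℕ} {q : Fin ℓ → ℝ} (hq : ∀ i, q i ∈ Set.Icc (0 : ℝ) 1)
    (x : Preambles ℓ n) : 0 ≤ preambleProb q x :=
  Finset.prod_nonneg fun i _ => Finset.prod_nonneg fun t _ => bern_nonneg (hq i) (x i t)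

lemma sum_preambleProb {ℓ n : ℕ} (q : Fin ℓ → ℝ) : ∑ x : Preambles ℓ n, preambleProb q x = 1 := by
  have := sum_pi_prod fun (i : Fin ℓ) (y : Fin n → Bool) => ∏ t, bern (q i) (y t)
  simp only [sum_prod_bern, Finset.prod_const_one] at this
  exact this

lemma preambleProb_eq_prod_colProb {ℓ n : ℕ} (q : ℝ) (x : Preambles ℓ n) :
    preambleProb (fun _ => q) x = ∏ t, colProb q fun i => x i t := by
  unfold preambleProb colProb bern
  exact Finset.prod_comm

/-- Expectations of products over the channel uses factorize. -/
lemma sum_preambleProb_prod {ℓ n : ℕ} (q : ℝ) (w f : (Fin ℓ → Bool) → Bool → ℝ) :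
    ∑ x : Preambles ℓ n, preambleProb (fun _ => q) x *
      ∑ z : Fin n → Bool, (∏ t, w (fun i => x i t) (z t)) * ∏ t, f (fun i => x i t) (z t) =
    (∑ c, colProb q c * ∑ b, w c b * f c b) ^ n := by
  have h1 : ∀ x : Preambles ℓ n, preambleProb (fun _ => q) x *
      ∑ z : Fin n → Bool, (∏ t, w (fun i => x i t) (z t)) * ∏ t, f (fun i => x i t) (z t) =
      ∏ t, (colProb q (fun i => x i t) *
        ∑ b, w (fun i => x i t) b * f (fun i => x i t) b) := by
    intro x
    rw [preambleProb_eq_prod_colProb, Finset.prod_mul_distrib,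
      ← sum_pi_prod fun t b => w (fun i => x i t) b * f (fun i => x i t) b]
    simp only [Finset.prod_mul_distrib]
  rw [Finset.sum_congr rfl fun x _ => h1 x]
  have h2 := sum_pi_prod fun (_ : Fin n) (c : Fin ℓ → Bool) =>
    colProb q c * ∑ b, w c b * f c b
  rw [Finset.prod_const, Finset.card_univ, Fintype.card_fin] at h2
  rw [← h2]
  exact (Equiv.piComm fun (_ : Fin ℓ) (_ : Fin n) => Bool).sum_comp
    fun y : Fin n → Fin ℓ → Bool => ∏ t, (colProb q (y t) * ∑ b, w (y t) b * f (y t) b)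

/-- With weight `1` on `A` and `w` elsewhere, the sum over all sets factorizes. The subsets of `A`
account for `2 ^ |A|`, and none of them is a different set of the same size. -/
lemma sum_pow_card_sdiff_le {ℓ : ℕ} {w : ℝ} (hw : 0 ≤ w) (A : Finset (Fin ℓ)) :
    ∑ A' ∈ (Finset.univ : Finset (Fin ℓ)).powersetCard A.card with A' ≠ A,
      w ^ (A' \ A).card ≤ 2 ^ A.card * ((1 + w) ^ ℓ - 1) := by
  set f : Fin ℓ → ℝ := fun i => if i ∈ A then 1 else w with hf
  have hprod : ∀ S : Finset (Fin ℓ), ∏ i ∈ S, f i = w ^ (S \ A).card := by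
    intro S
    rw [hf, Finset.prod_ite, Finset.prod_const_one, one_mul, Finset.prod_const,
      Finset.sdiff_eq_filter]
  have hall : ∑ S ∈ (Finset.univ : Finset (Fin ℓ)).powerset, ∏ i ∈ S, f i =
      2 ^ A.card * (1 + w) ^ (Finset.univ \ A).card := by
    rw [← Finset.prod_one_add]
    have : ∀ i, 1 + f i = if i ∈ A then 2 else 1 + w := by
      intro i
      by_cases h : i ∈ A <;> simp [hf, h]; norm_num
    simp only [this]
    rw [Finset.prod_ite, Finset.prod_const, Finset.prod_const, Finset.sdiff_eq_filter]
    simp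
  have hsub : ∑ S ∈ A.powerset, ∏ i ∈ S, f i = 2 ^ A.card := by
    have : ∀ S ∈ A.powerset, ∏ i ∈ S, f i = 1 := by
      intro S hS
      rw [hprod, Finset.sdiff_eq_empty_iff_subset.2 (Finset.mem_powerset.1 hS)]
      simp
    rw [Finset.sum_congr rfl this]
    simp [Finset.card_powerset]
  have hle : ∑ A' ∈ (Finset.univ : Finset (Fin ℓ)).powersetCard A.card with A' ≠ A,
      w ^ (A' \ A).card + ∑ S ∈ A.powerset, ∏ i ∈ S, f i ≤
      ∑ S ∈ (Finset.univ : Finset (Fin ℓ)).powerset, ∏ i ∈ S, f i := by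
    simp only [hprod]
    rw [← Finset.sum_union]
    · refine Finset.sum_le_sum_of_subset_of_nonneg ?_ fun S _ _ => pow_nonneg hw _
      intro S _
      exact Finset.mem_powerset.2 (Finset.subset_univ S)
    · rw [Finset.disjoint_left]
      intro S hS hSA
      obtain ⟨h1, h2⟩ := Finset.mem_filter.1 hS
      exact h2 (Finset.eq_of_subset_of_card_le (Finset.mem_powerset.1 hSA)
        (Finset.mem_powersetCard.1 h1).2.ge)
  rw [hall, hsub] at hle
  have hcard : (1 + w) ^ (Finset.univ \ A).card ≤ (1 + w) ^ ℓ := by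
    refine pow_le_pow_right₀ (by linarith) ?_
    calc _ ≤ (Finset.univ : Finset (Fin ℓ)).card := Finset.card_le_card Finset.sdiff_subset
      _ = ℓ := by simp
  have := mul_le_mul_of_nonneg_left hcard (by positivity : (0 : ℝ) ≤ 2 ^ A.card)
  linarith

/-- The set `A` is accepted if for each nonempty `D ⊆ A` the likelihood ratio of the observations
is larger than `w ^ (-|D|)`. -/
def Accepted {ℓ n : ℕ} (p : ℕ → ℝ) (q w : ℝ) (x : Preambles ℓ n) (z : Fin n → Bool)
    (A : Finset (Fin ℓ)) : Prop :=
  ∀ D ⊆ A, D.Nonempty → (w ^ D.card)⁻¹ < ∏ t, likRatio p q A D (fun i => x i t) (z t)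

open Classical in
/-- The detector that outputs an accepted `κ`-subset, if there is one. -/
def thresholdDetector {ℓ n κ : ℕ} (hκ : κ ≤ ℓ) (p : ℕ → ℝ) (q w : ℝ) (x : Preambles ℓ n) :
    Detector ℓ n κ where
  estimate z := if h : ∃ A : Finset (Fin ℓ), A.card = κ ∧ Accepted p q w x z A then h.choose
    else (Finset.exists_subset_card_eq (s := (Finset.univ : Finset (Fin ℓ))) (n := κ)
      (by simpa using hκ)).choose
  card_estimate z := by
    split_ifs with h
    · exact h.choose_spec.1
    · exact (Finset.exists_subset_card_eq (s := (Finset.univ : Finset (Fin ℓ))) (n := κ)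
        (by simpa using hκ)).choose_spec.2

lemma thresholdDetector_error {ℓ n κ : ℕ} (hκ : κ ≤ ℓ) {p : ℕ → ℝ} {q w : ℝ} {x : Preambles ℓ n}
    {A : Finset (Fin ℓ)} (hA : A.card = κ) {z : Fin n → Bool}
    (h : (thresholdDetector hκ p q w x).estimate z ≠ A) :
    ¬ Accepted p q w x z A ∨ ∃ A' : Finset (Fin ℓ), A'.card = κ ∧ A' ≠ A ∧
      Accepted p q w x z A' := by
  by_cases hacc : Accepted p q w x z A
  · right
    have hex : ∃ A : Finset (Fin ℓ), A.card = κ ∧ Accepted p q w x z A := ⟨A, hA, hacc⟩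
    refine ⟨hex.choose, hex.choose_spec.1, ?_, hex.choose_spec.2⟩
    simpa only [thresholdDetector, dif_pos hex] using h
  · exact Or.inl hacc

/-- The union bound for the threshold detector, with Chernoff bounds on each event. -/
lemma indicator_error_le {ℓ n κ : ℕ} (hκ : κ ≤ ℓ) {p : ℕ → ℝ}
    (hp : ∀ v, p v ∈ Set.Ioo (0 : ℝ) 1) {q w : ℝ} (hq : q ∈ Set.Icc (0 : ℝ) 1) (hw : 0 < w)
    {μ s : ℕ → ℝ} (hs : ∀ i ∈ Finset.Icc 1 κ, 0 < s i)
    (hμ : ∀ i ∈ Finset.Icc 1 κ, (w ^ i)⁻¹ ≤ Real.exp (n * μ i)) {x : Preambles ℓ n}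
    {A : Finset (Fin ℓ)} (hA : A.card = κ) {z : Fin n → Bool}
    (h : (thresholdDetector hκ p q w x).estimate z ≠ A) :
    1 ≤ ∑ D ∈ A.powerset with D.Nonempty, ∏ t, Real.exp (-s D.card *
        (Real.log (likRatio p q A D (fun i => x i t) (z t)) - μ D.card)) +
      ∑ A' ∈ (Finset.univ : Finset (Fin ℓ)).powersetCard κ with A' ≠ A,
        w ^ (A' \ A).card * ∏ t, likRatio p q A' (A' \ A) (fun i => x i t) (z t) := by
  have h1 : ∀ D ∈ A.powerset.filter fun D => D.Nonempty, 0 ≤ ∏ t, Real.exp (-s D.card *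
        (Real.log (likRatio p q A D (fun i => x i t) (z t)) - μ D.card)) := fun D _ =>
    Finset.prod_nonneg fun t _ => (Real.exp_pos _).le
  have h2 : ∀ A' ∈ ((Finset.univ : Finset (Fin ℓ)).powersetCard κ).filter fun A' => A' ≠ A,
      0 ≤ w ^ (A' \ A).card * ∏ t, likRatio p q A' (A' \ A) (fun i => x i t) (z t) := fun A' _ =>
    mul_nonneg (pow_nonneg hw.le _) (Finset.prod_nonneg fun t _ => (likRatio_pos hp hq _ _ _ _).le)
  rcases thresholdDetector_error hκ hA h with hacc | ⟨A', hA', hne, hacc⟩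
  · rw [Accepted] at hacc
    push Not at hacc
    obtain ⟨D, hD, hDne, hle⟩ := hacc
    refine le_add_of_le_of_nonneg ?_ (Finset.sum_nonneg h2)
    refine le_trans ?_ (Finset.single_le_sum h1
      (Finset.mem_filter.2 ⟨Finset.mem_powerset.2 hD, hDne⟩))
    have hcard : D.card ∈ Finset.Icc 1 κ :=
      Finset.mem_Icc.2 ⟨hDne.card_pos, hA ▸ Finset.card_le_card hD⟩
    have hpos : ∀ t, 0 < likRatio p q A D (fun i => x i t) (z t) := fun t =>
      likRatio_pos hp hq _ _ _ _
    have hlog := Real.log_le_log (Finset.prod_pos fun t _ => hpos t) (hle.trans (hμ _ hcard))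
    rw [Real.log_exp, Real.log_prod fun t _ => (hpos t).ne'] at hlog
    rw [← Real.exp_sum, ← Finset.mul_sum, Finset.sum_sub_distrib]
    refine Real.one_le_exp ?_
    rw [Finset.sum_const, Finset.card_univ, Fintype.card_fin, nsmul_eq_mul]
    have := mul_nonneg (hs _ hcard).le (sub_nonneg.2 hlog)
    linarith
  · refine le_add_of_nonneg_of_le (Finset.sum_nonneg h1) ?_
    refine le_trans ?_ (Finset.single_le_sum h2 (Finset.mem_filter.2
      ⟨Finset.mem_powersetCard.2 ⟨Finset.subset_univ _, hA'⟩, hne⟩))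
    have hne' : (A' \ A).Nonempty := by
      rw [Finset.sdiff_nonempty]
      exact fun hsub => hne (Finset.eq_of_subset_of_card_le hsub (by omega))
    -- The test of `A'` is used only at the users wrongly included, where the mean likelihood ratio
    -- is `1`.
    have := hacc (A' \ A) Finset.sdiff_subset hne'
    have hwp : 0 < w ^ (A' \ A).card := pow_pos hw _
    have h3 := mul_lt_mul_of_pos_left this hwp
    rw [mul_inv_cancel₀ hwp.ne'] at h3
    exact h3.le

/-- After averaging over preambles, each term of the union bound is an `n`-th power of a one-slot
mean: an exponential moment for a rejected truth, `1` for a wrong set. -/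
lemma sum_error_le {ℓ n κ : ℕ} (hκ : κ ≤ ℓ) {p : ℕ → ℝ}
    (hp : ∀ v, p v ∈ Set.Ioo (0 : ℝ) 1) {q w : ℝ} (hq : q ∈ Set.Icc (0 : ℝ) 1) (hw : 0 < w)
    {μ s : ℕ → ℝ} (hs : ∀ i ∈ Finset.Icc 1 κ, 0 < s i)
    (hμ : ∀ i ∈ Finset.Icc 1 κ, (w ^ i)⁻¹ ≤ Real.exp (n * μ i))
    {A : Finset (Fin ℓ)} (hA : A.card = κ) :
    ∑ x : Preambles ℓ n, preambleProb (fun _ => q) x *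
      ∑ z : Fin n → Bool with (thresholdDetector hκ p q w x).estimate z ≠ A,
        ∏ t, bern (p (onCount A fun i => x i t)) (z t) ≤
    2 ^ κ * ∑ i ∈ Finset.Icc 1 κ, expMoment p q κ i (μ i) (s i) ^ n +
      2 ^ κ * ((1 + w) ^ ℓ - 1) := by
  have hWpos : ∀ (x : Preambles ℓ n) (z : Fin n → Bool),
      0 ≤ ∏ t, bern (p (onCount A fun i => x i t)) (z t) := fun x z =>
    Finset.prod_nonneg fun t _ => (bern_pos (hp _) _).le
  have h1 : ∀ x : Preambles ℓ n,
      ∑ z : Fin n → Bool with (thresholdDetector hκ p q w x).estimate z ≠ A,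
        ∏ t, bern (p (onCount A fun i => x i t)) (z t) ≤
      ∑ z : Fin n → Bool, (∏ t, bern (p (onCount A fun i => x i t)) (z t)) *
        (∑ D ∈ A.powerset with D.Nonempty, ∏ t, Real.exp (-s D.card *
          (Real.log (likRatio p q A D (fun i => x i t) (z t)) - μ D.card)) +
        ∑ A' ∈ (Finset.univ : Finset (Fin ℓ)).powersetCard κ with A' ≠ A,
          w ^ (A' \ A).card * ∏ t, likRatio p q A' (A' \ A) (fun i => x i t) (z t)) := by
    intro x
    refine (Finset.sum_le_sum fun z hz => ?_).trans
      (Finset.sum_le_univ_sum_of_nonneg fun z => ?_)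
    · have := indicator_error_le hκ hp hq hw hs hμ hA (Finset.mem_filter.1 hz).2
      exact le_mul_of_one_le_right (hWpos x z) this
    · refine mul_nonneg (hWpos x z) (add_nonneg (Finset.sum_nonneg fun D _ => ?_)
        (Finset.sum_nonneg fun A' _ => ?_))
      · exact Finset.prod_nonneg fun t _ => (Real.exp_pos _).le
      · exact mul_nonneg (pow_nonneg hw.le _)
          (Finset.prod_nonneg fun t _ => (likRatio_pos hp hq _ _ _ _).le)
  refine (Finset.sum_le_sum fun x _ => mul_le_mul_of_nonneg_left (h1 x)
    (preambleProb_nonneg (fun _ => hq) x)).trans ?_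
  have h2 : ∀ x : Preambles ℓ n, preambleProb (fun _ => q) x *
      ∑ z : Fin n → Bool, (∏ t, bern (p (onCount A fun i => x i t)) (z t)) *
        (∑ D ∈ A.powerset with D.Nonempty, ∏ t, Real.exp (-s D.card *
          (Real.log (likRatio p q A D (fun i => x i t) (z t)) - μ D.card)) +
        ∑ A' ∈ (Finset.univ : Finset (Fin ℓ)).powersetCard κ with A' ≠ A,
          w ^ (A' \ A).card * ∏ t, likRatio p q A' (A' \ A) (fun i => x i t) (z t)) =
      ∑ D ∈ A.powerset with D.Nonempty, preambleProb (fun _ => q) x *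
        ∑ z : Fin n → Bool, (∏ t, bern (p (onCount A fun i => x i t)) (z t)) *
          ∏ t, Real.exp (-s D.card *
            (Real.log (likRatio p q A D (fun i => x i t) (z t)) - μ D.card)) +
      ∑ A' ∈ (Finset.univ : Finset (Fin ℓ)).powersetCard κ with A' ≠ A,
        w ^ (A' \ A).card * (preambleProb (fun _ => q) x *
          ∑ z : Fin n → Bool, (∏ t, bern (p (onCount A fun i => x i t)) (z t)) *
            ∏ t, likRatio p q A' (A' \ A) (fun i => x i t) (z t)) := by
    intro x
    simp only [mul_add, Finset.sum_add_distrib, Finset.mul_sum]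
    rw [Finset.sum_comm]
    congr 1
    rw [Finset.sum_comm]
    refine Finset.sum_congr rfl fun A' _ => Finset.sum_congr rfl fun z _ => by ring
  rw [Finset.sum_congr rfl fun x _ => h2 x, Finset.sum_add_distrib, Finset.sum_comm,
    Finset.sum_comm (s := Finset.univ)]
  simp only [← Finset.mul_sum]
  refine add_le_add ?_ ?_
  · have h3 : ∀ D ∈ A.powerset.filter fun D => D.Nonempty,
        ∑ x : Preambles ℓ n, preambleProb (fun _ => q) x *
          ∑ z : Fin n → Bool, (∏ t, bern (p (onCount A fun i => x i t)) (z t)) *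
            ∏ t, Real.exp (-s D.card *
              (Real.log (likRatio p q A D (fun i => x i t) (z t)) - μ D.card)) ≤
        ∑ i ∈ Finset.Icc 1 κ, expMoment p q κ i (μ i) (s i) ^ n := by
      intro D hD
      obtain ⟨hDA, hDne⟩ := Finset.mem_filter.1 hD
      have hDA := Finset.mem_powerset.1 hDA
      rw [sum_preambleProb_prod q (fun c b => bern (p (onCount A c)) b) fun c b =>
        Real.exp (-s D.card * (Real.log (likRatio p q A D c b) - μ D.card)),
        sum_colProb_expMoment hp hq hDA, hA]
      exact Finset.single_le_sum (f := fun i => expMoment p q κ i (μ i) (s i) ^ n)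
        (fun i _ => pow_nonneg (expMoment_nonneg hp hq _ _ _ _) n)
        (Finset.mem_Icc.2 ⟨hDne.card_pos, hA ▸ Finset.card_le_card hDA⟩)
    refine (Finset.sum_le_sum h3).trans ?_
    rw [Finset.sum_const, nsmul_eq_mul]
    refine mul_le_mul_of_nonneg_right ?_ (Finset.sum_nonneg fun i _ =>
      pow_nonneg (expMoment_nonneg hp hq _ _ _ _) n)
    have := Finset.card_filter_le A.powerset fun D => D.Nonempty
    rw [Finset.card_powerset, hA] at this
    exact_mod_cast this
  · have h4 : ∀ A' ∈ ((Finset.univ : Finset (Fin ℓ)).powersetCard κ).filter fun A' => A' ≠ A,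
        w ^ (A' \ A).card * ∑ x : Preambles ℓ n, preambleProb (fun _ => q) x *
          ∑ z : Fin n → Bool, (∏ t, bern (p (onCount A fun i => x i t)) (z t)) *
            ∏ t, likRatio p q A' (A' \ A) (fun i => x i t) (z t) = w ^ (A' \ A).card := by
      intro A' hA'
      have hcard := (Finset.mem_powersetCard.1 (Finset.mem_filter.1 hA').1).2
      rw [sum_preambleProb_prod q (fun c b => bern (p (onCount A c)) b) fun c b =>
        likRatio p q A' (A' \ A) c b, sum_colProb_likRatio hp hq (hA.trans hcard.symm), one_pow,
        mul_one]
    rw [Finset.sum_congr rfl h4, ← hA]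
    exact sum_pow_card_sdiff_le hw.le A

lemma bernoulliErrorProb_thresholdDetector_le {P σ σw γ : ℝ} (hP : 0 < P) (hσw : 0 < σw)
    (hγ : 0 < γ) {ℓ n κ : ℕ} (hκ : κ ≤ ℓ) {q w : ℝ} (hq : q ∈ Set.Icc (0 : ℝ) 1) (hw : 0 < w)
    {μ s : ℕ → ℝ} (hs : ∀ i ∈ Finset.Icc 1 κ, 0 < s i)
    (hμ : ∀ i ∈ Finset.Icc 1 κ, (w ^ i)⁻¹ ≤ Real.exp (n * μ i)) :
    bernoulliErrorProb P σ σw γ (fun _ => q) (fun x : Preambles ℓ n =>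
      thresholdDetector hκ (onProb P σ σw γ) q w x) ≤
    2 ^ κ * ∑ i ∈ Finset.Icc 1 κ, expMoment (onProb P σ σw γ) q κ i (μ i) (s i) ^ n +
      2 ^ κ * ((1 + w) ^ ℓ - 1) := by
  have hch : (0 : ℝ) < ℓ.choose κ := by exact_mod_cast Nat.choose_pos hκ
  rw [bernoulliErrorProb]
  simp only [errorProb_eq hP hσw hγ]
  simp only [mul_left_comm (preambleProb _ _), ← Finset.mul_sum]
  rw [one_div, inv_mul_le_iff₀ hch]
  simp only [Finset.mul_sum (Finset.powersetCard _ _)]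
  rw [Finset.sum_comm]
  refine (Finset.sum_le_sum fun A hA => sum_error_le hκ (onProb_mem_Ioo hP hσw hγ) hq hw hs hμ
    (Finset.mem_powersetCard.1 hA).2).trans ?_
  rw [Finset.sum_const, Finset.card_powersetCard, Finset.card_univ, Fintype.card_fin,
    nsmul_eq_mul]

/-! ### Random versus fixed preambles, and the limit for fixed `κ`. -/

lemma errorProb_nonneg (P σ σw γ : ℝ) {ℓ n k : ℕ} (x : Preambles ℓ n) (g : Detector ℓ n k) :
    0 ≤ errorProb P σ σw γ x g :=
  mul_nonneg (by positivity) (Finset.sum_nonneg fun _ _ => measureReal_nonneg)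

lemma bernoulliErrorProb_nonneg (P σ σw γ : ℝ) {ℓ n k : ℕ} {q : Fin ℓ → ℝ}
    (hq : ∀ i, q i ∈ Set.Icc (0 : ℝ) 1) (g : Preambles ℓ n → Detector ℓ n k) :
    0 ≤ bernoulliErrorProb P σ σw γ q g :=
  Finset.sum_nonneg fun x _ => mul_nonneg (preambleProb_nonneg hq x) (errorProb_nonneg ..)

/-- Some realization does at least as well as the average. -/
lemma exists_errorProb_le_bernoulliErrorProb (P σ σw γ : ℝ) {ℓ n k : ℕ} {q : Fin ℓ → ℝ}
    (hq : ∀ i, q i ∈ Set.Icc (0 : ℝ) 1) (g : Preambles ℓ n → Detector ℓ n k) :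
    ∃ x, errorProb P σ σw γ x (g x) ≤ bernoulliErrorProb P σ σw γ q g := by
  by_contra hcon
  push Not at hcon
  have h1 : ∑ x : Preambles ℓ n, preambleProb q x *
      (errorProb P σ σw γ x (g x) - bernoulliErrorProb P σ σw γ q g) = 0 := by
    simp only [mul_sub, Finset.sum_sub_distrib, ← Finset.sum_mul, sum_preambleProb, one_mul]
    exact sub_self _
  have h2 : ∀ x : Preambles ℓ n, preambleProb q x = 0 := by
    intro x
    have := (Finset.sum_eq_zero_iff_of_nonneg fun x _ => mul_nonneg (preambleProb_nonneg hq x)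
      (sub_nonneg.2 (hcon x).le)).1 h1 x (Finset.mem_univ x)
    exact (mul_eq_zero.1 this).resolve_right (sub_pos.2 (hcon x)).ne'
  have h3 := sum_preambleProb (n := n) q
  simp [h2] at h3

lemma le_bernoulliErrorProb {P σ σw γ δ : ℝ} {ℓ n k : ℕ} {q : Fin ℓ → ℝ}
    (hq : ∀ i, q i ∈ Set.Icc (0 : ℝ) 1) {g : Preambles ℓ n → Detector ℓ n k}
    (h : ∀ x, δ ≤ errorProb P σ σw γ x (g x)) : δ ≤ bernoulliErrorProb P σ σw γ q g := by
  obtain ⟨x, hx⟩ := exists_errorProb_le_bernoulliErrorProb P σ σw γ hq g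
  exact (h x).trans hx

/-- Choosing elements within `1 / (ℓ + 1)` of the infimum merges the choices for different `δ` into
one vanishing sequence. -/
lemma exists_seq_mem_tendsto_zero {S : ℕ → Set ℝ} (h0 : ∀ ℓ, ∀ r ∈ S ℓ, 0 ≤ r)
    (h : ∀ δ : ℝ, 0 < δ → ∀ᶠ ℓ in atTop, ∃ r ∈ S ℓ, r ≤ δ) :
    ∃ e : ℕ → ℝ, Tendsto e atTop (𝓝 0) ∧ ∀ᶠ ℓ in atTop, e ℓ ∈ S ℓ := by
  have hex : ∀ ℓ, ∃ r, (S ℓ).Nonempty → r ∈ S ℓ ∧ r < sInf (S ℓ) + 1 / ((ℓ : ℝ) + 1) := by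
    intro ℓ
    by_cases hne : (S ℓ).Nonempty
    · obtain ⟨r, hr, hlt⟩ := exists_lt_of_csInf_lt hne
        (lt_add_of_pos_right (sInf (S ℓ)) (by positivity : 0 < 1 / ((ℓ : ℝ) + 1)))
      exact ⟨r, fun _ => ⟨hr, hlt⟩⟩
    · exact ⟨0, fun hn => absurd hn hne⟩
  choose e he using hex
  refine ⟨e, ?_, ?_⟩
  · rw [Metric.tendsto_nhds]
    intro δ hδ
    filter_upwards [h (δ / 2) (by linarith), (tendsto_one_div_add_atTop_nhds_zero_nat
      (𝕜 := ℝ)).eventually (gt_mem_nhds (show (0 : ℝ) < δ / 2 by linarith))] with ℓ hℓ hℓ2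
    obtain ⟨r, hr, hrδ⟩ := hℓ
    obtain ⟨hm, hlt⟩ := he ℓ ⟨r, hr⟩
    have hinf : sInf (S ℓ) ≤ r := csInf_le ⟨0, fun r hr => h0 ℓ r hr⟩ hr
    rw [Real.dist_eq, sub_zero, abs_of_nonneg (h0 ℓ _ hm)]
    linarith
  · filter_upwards [h 1 one_pos] with ℓ hℓ
    obtain ⟨r, hr, -⟩ := hℓ
    exact (he ℓ ⟨r, hr⟩).1

lemma eventually_exists_detector {P σ σw : ℝ} (hP : 0 < P) (hσ : 0 < σ) (hσw : 0 < σw) {κ : ℕ}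
    (hκ : 1 ≤ κ) {γ q : ℝ} (hγ : 0 < γ) (hq : q ∈ Set.Icc (0 : ℝ) 1)
    (hmax : rate P σ σw κ γ q = maxRate P σ σw κ) {ε δ : ℝ} (hε : 0 < ε) (hδ : 0 < δ) :
    ∀ᶠ ℓ : ℕ in atTop,
      ∃ g : Preambles ℓ ⌈(1 + ε) * ((κ : ℝ) * Real.logb 2 ℓ / maxRate P σ σw κ)⌉₊ →
          Detector ℓ ⌈(1 + ε) * ((κ : ℝ) * Real.logb 2 ℓ / maxRate P σ σw κ)⌉₊ κ,
        bernoulliErrorProb P σ σw γ (fun _ => q) g ≤ δ := by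
  set C := maxRate P σ σw κ with hC
  have hC0 : 0 < C := maxRate_pos hP hσ hσw hκ
  have hlog2 : 0 < Real.log 2 := Real.log_pos one_lt_two
  have hκ0 : (0 : ℝ) < κ := by exact_mod_cast hκ
  set p := onProb P σ σw γ with hp
  have hpm : ∀ v, p v ∈ Set.Ioo (0 : ℝ) 1 := onProb_mem_Ioo hP hσw hγ
  have hR : condEntropy p q κ κ - condEntropy p q κ 0 = C * Real.log 2 := by
    rw [← hmax, rate_eq_condEntropy, div_mul_cancel₀ _ hlog2.ne']
  -- The share `i / κ` of the total information, reduced by a factor below `1`. That factor turns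
  -- the `1 + ε` of the blocklength into the `1 + ε / 2` of the test threshold.
  set μ : ℕ → ℝ := fun i => (1 + ε / 2) / (1 + ε) * (i / κ * (C * Real.log 2)) with hμ
  have hμlt : ∀ i ∈ Finset.Icc 1 κ, μ i < condEntropy p q κ i - condEntropy p q κ 0 := by
    intro i hi
    obtain ⟨hi1, hi2⟩ := Finset.mem_Icc.1 hi
    have hi0 : (0 : ℝ) < i := by exact_mod_cast hi1
    have h1 := concave_seq_average (F := condEntropy p q κ) (fun j hj => condEntropy_concave hpm hq hj) hi1 hi2
    rw [hR] at h1
    have h2 : (i : ℝ) / κ * (C * Real.log 2) ≤ condEntropy p q κ i - condEntropy p q κ 0 := by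
      rw [div_mul_eq_mul_div, div_le_iff₀ hκ0]
      linarith
    refine lt_of_lt_of_le ?_ h2
    refine mul_lt_of_lt_one_left (by positivity) ?_
    rw [div_lt_one (by linarith)]
    linarith
  have hs : ∀ i, ∃ s, i ∈ Finset.Icc 1 κ → 0 < s ∧ expMoment p q κ i (μ i) s < 1 := by
    intro i
    by_cases hi : i ∈ Finset.Icc 1 κ
    · obtain ⟨s, hs⟩ := exists_expMoment_lt_one (Finset.mem_Icc.1 hi).2 (hμlt i hi)
      exact ⟨s, fun _ => hs⟩
    · exact ⟨0, fun h => absurd h hi⟩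
  choose s hs using hs
  set N : ℕ → ℕ := fun ℓ => ⌈(1 + ε) * ((κ : ℝ) * Real.logb 2 ℓ / C)⌉₊ with hN
  have hlog : Tendsto (fun ℓ : ℕ => Real.log ℓ) atTop atTop :=
    Real.tendsto_log_atTop.comp tendsto_natCast_atTop_atTop
  have hNtop : Tendsto N atTop atTop := by
    refine tendsto_nat_ceil_atTop.comp ?_
    refine Tendsto.const_mul_atTop (by linarith) ?_
    refine Tendsto.atTop_div_const hC0 ?_
    refine Tendsto.const_mul_atTop hκ0 ?_
    exact hlog.atTop_div_const hlog2
  -- `w = ℓ ^ (-(1 + ε / 2))`: small enough that `ℓ * w → 0`, so wrong sets are negligible.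
  set w : ℕ → ℝ := fun ℓ => Real.exp (-((1 + ε / 2) * Real.log ℓ)) with hw
  have hlim1 : Tendsto (fun ℓ => 2 ^ κ * ∑ i ∈ Finset.Icc 1 κ,
      expMoment p q κ i (μ i) (s i) ^ N ℓ) atTop (𝓝 (2 ^ κ * ∑ i ∈ Finset.Icc 1 κ, (0 : ℝ))) := by
    refine Tendsto.const_mul _ (tendsto_finsetSum _ fun i hi => ?_)
    exact (tendsto_pow_atTop_nhds_zero_of_lt_one (expMoment_nonneg hpm hq _ _ _ _)
      (hs i hi).2).comp hNtop
  have hlim2 : Tendsto (fun ℓ : ℕ => (2 : ℝ) ^ κ * (Real.exp (Real.exp (-(ε / 2 * Real.log ℓ))) - 1))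
      atTop (𝓝 (2 ^ κ * (Real.exp 0 - 1))) := by
    refine Tendsto.const_mul _ (Tendsto.sub_const ?_ 1)
    refine (Real.continuous_exp.tendsto 0).comp ?_
    exact Real.tendsto_exp_neg_atTop_nhds_zero.comp (hlog.const_mul_atTop (by linarith))
  have hlim := hlim1.add hlim2
  rw [Finset.sum_const_zero, mul_zero, Real.exp_zero, sub_self, mul_zero, add_zero] at hlim
  filter_upwards [hlim.eventually (gt_mem_nhds hδ), eventually_ge_atTop κ] with ℓ h1 h2
  have hℓ0 : (0 : ℝ) < ℓ := by exact_mod_cast (by omega : 0 < ℓ)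
  have hlogℓ : 0 ≤ Real.log ℓ := Real.log_natCast_nonneg ℓ
  have hNge : (1 + ε) * (κ * Real.log ℓ) ≤ N ℓ * (C * Real.log 2) := by
    have h3 : (1 + ε) * ((κ : ℝ) * Real.logb 2 ℓ / C) ≤ N ℓ := Nat.le_ceil _
    have h4 := mul_le_mul_of_nonneg_right h3 (mul_pos hC0 hlog2).le
    refine le_trans (le_of_eq ?_) h4
    rw [Real.logb]
    field_simp
  have hwpos : 0 < w ℓ := Real.exp_pos _
  have hμw : ∀ i ∈ Finset.Icc 1 κ, (w ℓ ^ i)⁻¹ ≤ Real.exp (N ℓ * μ i) := by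
    intro i _
    simp only [hw]
    rw [← Real.exp_nat_mul, ← Real.exp_neg, Real.exp_le_exp]
    have h5 := mul_le_mul_of_nonneg_left hNge
      (show 0 ≤ (1 + ε / 2) / (1 + ε) * ((i : ℝ) / κ) by positivity)
    have h6 : (1 + ε / 2) / (1 + ε) * ((i : ℝ) / κ) * ((1 + ε) * (κ * Real.log ℓ)) =
        -(i * -((1 + ε / 2) * Real.log ℓ)) := by
      field_simp
    have h7 : (1 + ε / 2) / (1 + ε) * ((i : ℝ) / κ) * (N ℓ * (C * Real.log 2)) = N ℓ * μ i := by
      simp only [hμ]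
      ring
    rwa [h6, h7] at h5
  refine ⟨fun x => thresholdDetector h2 p q (w ℓ) x, ?_⟩
  refine (bernoulliErrorProb_thresholdDetector_le hP hσw hγ h2 hq hwpos (fun i hi => (hs i hi).1)
    hμw).trans ?_
  refine le_trans (add_le_add le_rfl (mul_le_mul_of_nonneg_left ?_ (by positivity))) h1.le
  refine sub_le_sub_right ?_ 1
  -- The right side is `exp (ℓ * w) = exp (ℓ ^ (-ε / 2))`, which tends to `1`.
  have h8 : (1 + w ℓ) ^ ℓ ≤ Real.exp (w ℓ) ^ ℓ :=
    pow_le_pow_left₀ (by linarith) (by linarith [Real.add_one_le_exp (w ℓ)]) ℓ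
  refine h8.trans (le_of_eq ?_)
  rw [← Real.exp_nat_mul]
  congr 1
  simp only [hw]
  nth_rewrite 1 [← Real.exp_log hℓ0]
  rw [← Real.exp_add]
  congr 1
  ring

/-! ### From fixed `κ` to bounded `k`, and the theorem. -/

lemma eventually_mem_Icc_of_isTheta_one {k : ℕ → ℕ}
    (hk : (fun ℓ : ℕ => (k ℓ : ℝ)) =Θ[atTop] (fun _ : ℕ => (1 : ℝ))) :
    ∃ K, ∀ᶠ ℓ in atTop, k ℓ ∈ Finset.Icc 1 K := by
  obtain ⟨c, hc⟩ := hk.1.bound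
  obtain ⟨d, hd⟩ := hk.2.bound
  refine ⟨⌊c⌋₊, ?_⟩
  filter_upwards [hc, hd] with ℓ h1 h2
  rw [Finset.mem_Icc]
  constructor
  · by_contra h
    have : k ℓ = 0 := by omega
    simp [this] at h2
    linarith
  · refine Nat.le_floor ?_
    simpa using h1

/-- A property that holds eventually for each fixed number of active users holds eventually for a
bounded number of active users. -/
lemma eventually_of_forall_fixed {k : ℕ → ℕ}
    (hk : (fun ℓ : ℕ => (k ℓ : ℝ)) =Θ[atTop] (fun _ : ℕ => (1 : ℝ))) {p : ℕ → ℕ → Prop}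
    (h : ∀ κ, 1 ≤ κ → ∀ᶠ ℓ in atTop, p κ ℓ) : ∀ᶠ ℓ in atTop, p (k ℓ) ℓ := by
  obtain ⟨K, hK⟩ := eventually_mem_Icc_of_isTheta_one hk
  have hall : ∀ᶠ ℓ in atTop, ∀ κ ∈ Finset.Icc 1 K, p κ ℓ :=
    (Filter.eventually_all_finset _).2 fun κ hκ => h κ (Finset.mem_Icc.1 hκ).1
  filter_upwards [hK, hall] with ℓ h1 h2
  exact h2 _ h1

lemma exists_maximizer {P σ σw : ℝ} (hP : 0 < P) (hσ : 0 < σ) (hσw : 0 < σw) :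
    ∃ γ q : ℕ → ℝ, ∀ κ : ℕ, 1 ≤ κ → 0 < γ κ ∧ q κ ∈ Set.Icc (0 : ℝ) 1 ∧
      rate P σ σw κ (γ κ) (q κ) = maxRate P σ σw κ := by
  have : ∀ κ : ℕ, ∃ γ q : ℝ, 1 ≤ κ → 0 < γ ∧ q ∈ Set.Icc (0 : ℝ) 1 ∧
      rate P σ σw κ γ q = maxRate P σ σw κ := by
    intro κ
    by_cases hκ : 1 ≤ κ
    · obtain ⟨γ, q, hγ, hq, heq⟩ := (isGreatest_maxRate hP hσ hσw hκ).1
      exact ⟨γ, q, fun _ => ⟨hγ, hq, heq.symm⟩⟩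
    · exact ⟨0, 0, fun h => absurd h hκ⟩
  choose γ q h using this
  exact ⟨γ, q, h⟩

end MnAC

end

theorem theorem1 (P σ σw : ℝ) (hP : 0 < P) (hσ : 0 < σ) (hσw : 0 < σw)
    (k : ℕ → ℕ) (hk : (fun ℓ : ℕ => (k ℓ : ℝ)) =Θ[atTop] (fun _ : ℕ => (1 : ℝ))) :
    -- the maximum that defines `C` is attained and positive
    (∀ κ : ℕ, 1 ≤ κ → IsGreatest (MnAC.rateSet P σ σw κ) (MnAC.maxRate P σ σw κ) ∧
      0 < MnAC.maxRate P σ σw κ) ∧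
    -- `k log ℓ / C` is the minimum user identification cost, with Bernoulli preambles
    MnAC.IsMinCostBernoulli P σ σw k
      (fun ℓ => (k ℓ : ℝ) * Real.logb 2 ℓ / MnAC.maxRate P σ σw (k ℓ)) ∧
    -- and also when the preambles may be chosen freely
    MnAC.IsMinCostFixed P σ σw k
      (fun ℓ => (k ℓ : ℝ) * Real.logb 2 ℓ / MnAC.maxRate P σ σw (k ℓ)) ∧
    -- any maximising threshold and common sampling probability achieve it
    (∀ γ q : ℕ → ℝ,
      (∀ κ : ℕ, 1 ≤ κ → 0 < γ κ ∧ q κ ∈ Set.Icc (0 : ℝ) 1 ∧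
        MnAC.rate P σ σw κ (γ κ) (q κ) = MnAC.maxRate P σ σw κ) →
      ∀ ε : ℝ, 0 < ε → ε < 1 → ∃ e : ℕ → ℝ, Tendsto e atTop (𝓝 0) ∧ ∀ᶠ ℓ in atTop,
        ∃ g : MnAC.Preambles ℓ
              ⌈(1 + ε) * ((k ℓ : ℝ) * Real.logb 2 ℓ / MnAC.maxRate P σ σw (k ℓ))⌉₊ →
            MnAC.Detector ℓ
              ⌈(1 + ε) * ((k ℓ : ℝ) * Real.logb 2 ℓ / MnAC.maxRate P σ σw (k ℓ))⌉₊ (k ℓ),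
          MnAC.bernoulliErrorProb P σ σw (γ (k ℓ)) (fun _ => q (k ℓ)) g = e ℓ) := by
  have ach : ∀ γ q : ℕ → ℝ,
      (∀ κ : ℕ, 1 ≤ κ → 0 < γ κ ∧ q κ ∈ Set.Icc (0 : ℝ) 1 ∧
        MnAC.rate P σ σw κ (γ κ) (q κ) = MnAC.maxRate P σ σw κ) →
      ∀ ε : ℝ, 0 < ε → ∀ δ : ℝ, 0 < δ → ∀ᶠ ℓ in atTop, (1 ≤ k ℓ) ∧
        ∃ g : MnAC.Preambles ℓ
              ⌈(1 + ε) * ((k ℓ : ℝ) * Real.logb 2 ℓ / MnAC.maxRate P σ σw (k ℓ))⌉₊ →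
            MnAC.Detector ℓ
              ⌈(1 + ε) * ((k ℓ : ℝ) * Real.logb 2 ℓ / MnAC.maxRate P σ σw (k ℓ))⌉₊ (k ℓ),
          MnAC.bernoulliErrorProb P σ σw (γ (k ℓ)) (fun _ => q (k ℓ)) g ≤ δ := by
    intro γ q hγq ε hε δ hδ
    refine MnAC.eventually_of_forall_fixed hk (p := fun κ ℓ => 1 ≤ κ ∧
      ∃ g : MnAC.Preambles ℓ
              ⌈(1 + ε) * ((κ : ℝ) * Real.logb 2 ℓ / MnAC.maxRate P σ σw κ)⌉₊ →
            MnAC.Detector ℓ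
              ⌈(1 + ε) * ((κ : ℝ) * Real.logb 2 ℓ / MnAC.maxRate P σ σw κ)⌉₊ κ,
          MnAC.bernoulliErrorProb P σ σw (γ κ) (fun _ => q κ) g ≤ δ) fun κ hκ => ?_
    obtain ⟨h1, h2, h3⟩ := hγq κ hκ
    filter_upwards [MnAC.eventually_exists_detector hP hσ hσw hκ h1 h2 h3 hε hδ] with ℓ h
    exact ⟨hκ, h⟩
  have conv : ∀ ε : ℝ, 0 < ε → ε < 1 → ∀ᶠ ℓ in atTop,
      ∀ (γ : ℝ) (x : MnAC.Preambles ℓ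
          ⌊(1 - ε) * ((k ℓ : ℝ) * Real.logb 2 ℓ / MnAC.maxRate P σ σw (k ℓ))⌋₊)
        (g : MnAC.Detector ℓ
          ⌊(1 - ε) * ((k ℓ : ℝ) * Real.logb 2 ℓ / MnAC.maxRate P σ σw (k ℓ))⌋₊ (k ℓ)),
        0 < γ → ε / 2 ≤ MnAC.errorProb P σ σw γ x g := by
    intro ε hε hε1
    refine MnAC.eventually_of_forall_fixed hk (p := fun κ ℓ =>
      ∀ (γ : ℝ) (x : MnAC.Preambles ℓ
          ⌊(1 - ε) * ((κ : ℝ) * Real.logb 2 ℓ / MnAC.maxRate P σ σw κ)⌋₊)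
        (g : MnAC.Detector ℓ
          ⌊(1 - ε) * ((κ : ℝ) * Real.logb 2 ℓ / MnAC.maxRate P σ σw κ)⌋₊ κ),
        0 < γ → ε / 2 ≤ MnAC.errorProb P σ σw γ x g) fun κ hκ => ?_
    filter_upwards [MnAC.eventually_errorProb_ge hP hσ hσw hκ hε, eventually_ge_atTop 1]
      with ℓ h h1 γ x g hγ
    refine h γ _ x g hγ (Nat.floor_le ?_)
    have hC := MnAC.maxRate_pos hP hσ hσw hκ
    have hlog : 0 ≤ Real.logb 2 ℓ := Real.logb_nonneg one_lt_two (by exact_mod_cast h1)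
    exact mul_nonneg (by linarith) (by positivity)
  obtain ⟨γ₀, q₀, hmax⟩ := MnAC.exists_maximizer hP hσ hσw
  refine ⟨fun κ hκ => ⟨MnAC.isGreatest_maxRate hP hσ hσw hκ, MnAC.maxRate_pos hP hσ hσw hκ⟩,
    fun ε hε hε1 => ⟨?_, ε / 2, by linarith, ?_⟩, fun ε hε hε1 => ⟨?_, ε / 2, by linarith, ?_⟩, ?_⟩
  · refine MnAC.exists_seq_mem_tendsto_zero (S := fun ℓ => {r | ∃ (γ : ℝ) (q : Fin ℓ → ℝ)
      (g : MnAC.Preambles ℓ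
          ⌈(1 + ε) * ((k ℓ : ℝ) * Real.logb 2 ℓ / MnAC.maxRate P σ σw (k ℓ))⌉₊ →
        MnAC.Detector ℓ
          ⌈(1 + ε) * ((k ℓ : ℝ) * Real.logb 2 ℓ / MnAC.maxRate P σ σw (k ℓ))⌉₊ (k ℓ)),
      0 < γ ∧ (∀ i, q i ∈ Set.Icc (0 : ℝ) 1) ∧ MnAC.bernoulliErrorProb P σ σw γ q g = r}) ?_ ?_
    · rintro ℓ r ⟨γ, q, g, -, hq, rfl⟩
      exact MnAC.bernoulliErrorProb_nonneg P σ σw γ hq g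
    · intro δ hδ
      filter_upwards [ach γ₀ q₀ hmax ε hε δ hδ] with ℓ ⟨hk1, g, hg⟩
      exact ⟨_, ⟨γ₀ (k ℓ), fun _ => q₀ (k ℓ), g, (hmax _ hk1).1, fun _ => (hmax _ hk1).2.1, rfl⟩,
        hg⟩
  · filter_upwards [conv ε hε hε1] with ℓ h γ q g hγ hq
    exact MnAC.le_bernoulliErrorProb hq fun x => h γ x (g x) hγ
  · refine MnAC.exists_seq_mem_tendsto_zero (S := fun ℓ => {r | ∃ (γ : ℝ)
      (x : MnAC.Preambles ℓ
          ⌈(1 + ε) * ((k ℓ : ℝ) * Real.logb 2 ℓ / MnAC.maxRate P σ σw (k ℓ))⌉₊)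
      (g : MnAC.Detector ℓ
          ⌈(1 + ε) * ((k ℓ : ℝ) * Real.logb 2 ℓ / MnAC.maxRate P σ σw (k ℓ))⌉₊ (k ℓ)),
      0 < γ ∧ MnAC.errorProb P σ σw γ x g = r}) ?_ ?_
    · rintro ℓ r ⟨γ, x, g, -, rfl⟩
      exact MnAC.errorProb_nonneg P σ σw γ x g
    · intro δ hδ
      filter_upwards [ach γ₀ q₀ hmax ε hε δ hδ] with ℓ ⟨hk1, g, hg⟩
      obtain ⟨x, hx⟩ := MnAC.exists_errorProb_le_bernoulliErrorProb P σ σw (γ₀ (k ℓ))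
        (q := fun _ => q₀ (k ℓ)) (fun _ => (hmax _ hk1).2.1) g
      exact ⟨_, ⟨γ₀ (k ℓ), x, g x, (hmax _ hk1).1, rfl⟩, hx.trans hg⟩
  · exact conv ε hε hε1
  · intro γ q hγq ε hε hε1
    have hbdd := ach γ q hγq ε hε
    -- Nonnegativity is required at every `ℓ`, while `q` is a probability only for `κ ≥ 1`; the
    -- condition `1 ≤ k ℓ` empties the set at the exceptional `ℓ`.
    obtain ⟨e, he, hmem⟩ := MnAC.exists_seq_mem_tendsto_zero (S := fun ℓ => {r | 1 ≤ k ℓ ∧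
      ∃ g : MnAC.Preambles ℓ
          ⌈(1 + ε) * ((k ℓ : ℝ) * Real.logb 2 ℓ / MnAC.maxRate P σ σw (k ℓ))⌉₊ →
        MnAC.Detector ℓ
          ⌈(1 + ε) * ((k ℓ : ℝ) * Real.logb 2 ℓ / MnAC.maxRate P σ σw (k ℓ))⌉₊ (k ℓ),
      MnAC.bernoulliErrorProb P σ σw (γ (k ℓ)) (fun _ => q (k ℓ)) g = r})
      (by
        rintro ℓ r ⟨hk1, g, rfl⟩
        exact MnAC.bernoulliErrorProb_nonneg P σ σw _ (fun _ => (hγq _ hk1).2.1) g)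
      (by
        intro δ hδ
        filter_upwards [hbdd δ hδ] with ℓ ⟨hk1, g, hg⟩
        exact ⟨_, ⟨hk1, g, rfl⟩, hg⟩)
    refine ⟨e, he, ?_⟩
    filter_upwards [hmem] with ℓ h
    exact h.2
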